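/- Let $S^1=\mathbb R/\mathbb Z$ and let $h(\theta)=2\theta \bmod 1$ be angle doubling. **Characteristic arcs.** An orbit portrait is a finite collection $\{O_1,\dots,O_p\}$ ($p\ge 1$, indices mod $p$) of nonempty finite subsets of $S^1$, all of the same cardinality, such that $h$ maps each $O_j$ bijectively onto $O_{j+1}$ and preserves the cyclic order on $O_j$, all angles in $\bigcup_j O_j$ are periodic under $h$ with one common period, which is a multiple of $p$, and for $i\ne j$ the polygons inscribed in the circle with vertex sets $O_i$ and $O_j$ are disjoint. A complementary arc of $O_j$ is an open arc $(x,y)$, positively oriented, with distinct endpoints $x,y\in O_j$ and containing no point of $O_j$. A characteristic arc $(\alpha,\overline\alpha)$ is a complementary arc of some member of an orbit portrait, of minimal length among all complementary arcs of all members of that portrait; $\overline\alpha$ is called the companion angle of $\alpha$. Let $n=\mathrm{PER}(\alpha)$ be the period of $\alpha$ under $h$. The arc $(\alpha,\overline\alpha)$ is narrow if its length is $\frac1{2^n-1}$. **Itineraries.** Represent $\alpha$ in $[0,1)$. The itinerary $I^\alpha(\theta)=x_0x_1x_2\cdots$ has $x_i=0$ if $2^i\theta$ lies in the open arc from $\frac\alpha2$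 to $\frac{\alpha+1}2$, $x_i=1$ if $2^i\theta$ lies in the open arc from $\frac{\alpha+1}2$ to $\frac\alpha2$, and $x_i=*$ if $2^i\theta$ is one of the two endpoints. An angle $\theta$ is precritical for $\alpha$ if $h^k(\theta)=\alpha$ for some $k\ge0$. The repetition word $v=v^\alpha$ is the word of length $n-1$ formed by the first $n-1$ symbols of $I^\alpha(\alpha)=\overline{v*}$. **Characteristic symbol.** Let $\dot\alpha=h^{n-1}(\alpha)$ and $\ddot\alpha=\dot\alpha+\frac12$ be the two preimages of $\alpha$ under $h$. For $s,t\in\{0,1\}$ let $l^{\alpha,t}_s(x)$ be, for $x\ne\alpha$, the preimage of $x$ under $h$ lying in the arc with symbol $s$, and let $l^{\alpha,t}_s(\alpha)=\dot\alpha$ if $t=s$ and $\ddot\alpha$ if $t\neq s$; for a word $w=w_1\cdots w_m$ put $l^{\alpha,t}_w=l^{\alpha,t}_{w_1}\circ\cdots\circ l^{\alpha,t}_{w_m}$. The characteristic symbol $e=e^\alpha$ is the $t\in\{0,1\}$ for which the circle distance between $l^{\alpha,t}_{0v}(\dot\alpha)$ and $l^{\alpha,t}_{0v}(\ddot\alpha)$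 is less than $\frac14$. **The algorithm $\varphi_\alpha$.** Let $s=s_0s_1s_2\cdots$ be a $0$-$1$ sequence. A block at $i$ is an occurrence $s_i\cdots s_{i+|v|}\in\{0v,1v\}$. Scan $s$ from $i=0$ as follows. 1. If there is a block at $i$, append it to the current run of consecutive blocks, set $i\leftarrow i+|v|+1$ and repeat step 1. 2. If there is no block at $i$, trace back. While the current run is nonempty and $s_i\ne e$, set $i$ to the start of the last block of the run and remove that block from the run. When this stops, swap $0v\leftrightarrow1v$ in all blocks that remain in the run (none, if the run has become empty); then set $i\leftarrow i+1$, begin a new, empty run and go to step 1. All tests refer to the original sequence $s$. If a run of consecutive blocks never ends, all blocks of this run are swapped. The sequence that results is $\varphi_\alpha(s)$. **Theorem.** Suppose that $(\alpha,\overline\alpha)$ is a narrow characteristic arc, and let $\theta\in S^1$ be a (dynamic) angle that is precritical neither for $\alpha$ nor for $\overline\alpha$. Then $I^\alpha(\theta)$ and $I^{\overline\alpha}(\theta)$ are $0$-$1$ sequences, and $$\varphi_\alpha\bigl(I^\alpha(\theta)\bigr)=I^{\overline\alpha}(\theta).$$ -/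

import Mathlib

namespace Narrow

/-! ### Angles, doubling, and orbit portraits -/

/-- The circle `ℝ / ℤ` of angles. -/
abbrev Angle : Type := UnitAddCircle

/-- Angle doubling `h : θ ↦ 2θ mod 1`. -/
def double (θ : Angle) : Angle := 2 • θ

/-- The period of an angle under doubling (it is `0` if the angle is not periodic). -/
noncomputable def period (θ : Angle) : ℕ := Function.minimalPeriod double θ

/-- Length of the arc that runs from `x` to `y` in the positive direction,
i.e. the representative of `y - x` in `[0, 1)`. -/
noncomputable def arcLength (x y : Angle) : ℝ := (AddCircle.equivIco (1 : ℝ) 0 (y - x) : ℝ)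

/-- Orbit portraits `{O 0, …, O (p - 1)}`, with indices modulo `p`. -/
structure IsOrbitPortrait (p : ℕ) (O : ZMod p → Finset Angle) : Prop where
  pos : 0 < p
  nonempty : ∀ j, (O j).Nonempty
  card_eq : ∀ i j, (O i).card = (O j).card
  bijOn : ∀ j, Set.BijOn double (O j) (O (j + 1))
  cyclic : ∀ j, ∀ a ∈ O j, ∀ b ∈ O j, ∀ c ∈ O j,
    sbtw a b c → sbtw (double a) (double b) (double c)
  /-- All angles are periodic, of the same period `r * p`. -/
  periodic : ∃ r : ℕ, 0 < r ∧ ∀ j, ∀ a ∈ O j, period a = r * p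
  /-- For `i ≠ j`, the polygons inscribed in the circle with vertex sets `O i` and `O j` do not
  meet: they share no vertex, and no chord `ab` of the first crosses a chord `cd` of the second. -/
  unlinked : ∀ i j, i ≠ j → Disjoint (O i) (O j) ∧
    ∀ a ∈ O i, ∀ b ∈ O i, ∀ c ∈ O j, ∀ d ∈ O j, ¬ (sbtw a c b ∧ sbtw b d a)

/-- The positively oriented open arc from `x` to `y` is a complementary arc of `S`: its endpoints
are two points of `S`, and it contains no point of `S`. -/
def IsComplementaryArc (S : Finset Angle) (x y : Angle) : Prop :=
  x ∈ S ∧ y ∈ S ∧ x ≠ y ∧ ∀ z ∈ S, ¬ sbtw x z y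

/-- `(α, β)` is a characteristic arc: for some orbit portrait, it is a complementary arc of one of
its members, and it is of minimal length among all complementary arcs of all members. -/
def IsCharacteristicArc (α β : Angle) : Prop :=
  ∃ (p : ℕ) (O : ZMod p → Finset Angle), IsOrbitPortrait p O ∧
    (∃ j, IsComplementaryArc (O j) α β) ∧
    ∀ j x y, IsComplementaryArc (O j) x y → arcLength α β ≤ arcLength x y

/-- A characteristic arc of period `n` is narrow if its length is `1 / (2 ^ n - 1)`. -/
def IsNarrowArc (α β : Angle) : Prop :=
  IsCharacteristicArc α β ∧ arcLength α β = 1 / ((2 : ℝ) ^ period α - 1)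

/-! ### Itineraries -/

/-- The angle `x / 2`, where `x` is represented in `[0, 1)`. -/
noncomputable def half (x : Angle) : Angle :=
  (((AddCircle.equivIco (1 : ℝ) 0 x : ℝ) / 2 : ℝ) : Angle)

/-- The angle `(x + 1) / 2`, where `x` is represented in `[0, 1)`. -/
noncomputable def half' (x : Angle) : Angle :=
  ((((AddCircle.equivIco (1 : ℝ) 0 x : ℝ) + 1) / 2 : ℝ) : Angle)

open Classical in
/-- The symbol of `θ`: it is `0` on the open arc from `α / 2` to `(α + 1) / 2`, it is `1` on the
open arc from `(α + 1) / 2` to `α / 2`, and at the two end points it is `*`, written `none`. -/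
noncomputable def symbol (α θ : Angle) : Option (Fin 2) :=
  if sbtw (half α) θ (half' α) then some 0
  else if sbtw (half' α) θ (half α) then some 1
  else none

/-- The itinerary (kneading sequence) `I^α(θ)`. -/
noncomputable def itinerary (α θ : Angle) (i : ℕ) : Option (Fin 2) :=
  symbol α (double^[i] θ)

/-- `θ` is precritical for `α`: some iterate of `θ` under doubling is `α`. (For periodic `α` this
says that some iterate of `θ` is `α / 2` or `(α + 1) / 2`.) -/
def IsPrecritical (α θ : Angle) : Prop := ∃ k : ℕ, double^[k] θ = α

/-- The repetition word `v^α`, for a periodic `α` of period `n`: the first `n - 1` symbols of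
`I^α(α)`, which is the periodic sequence with repeating block `v^α *`. None of these symbols
is `*`, so that the default value `0` is never used. -/
noncomputable def repetitionWord (α : Angle) : List (Fin 2) :=
  List.ofFn fun k : Fin (period α - 1) => (itinerary α α k).getD 0

/-! ### The characteristic symbol -/

/-- `α̇`, the periodic preimage of the periodic angle `α`. -/
noncomputable def dot (α : Angle) : Angle := double^[period α - 1] α

/-- `α̈`, the other preimage of `α`, antipodal to `α̇`. -/
noncomputable def ddot (α : Angle) : Angle := dot α + ((1 / 2 : ℝ) : Angle)

open Classical in
/-- The inverse branch `l^{α,t}_s` of doubling. For `x ≠ α` its value is the preimage of `x` with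
symbol `s`; the value at `α` is `α̇` if `t = s`, and `α̈` otherwise. -/
noncomputable def branch (α : Angle) (t s : Fin 2) (x : Angle) : Angle :=
  if x = α then (if t = s then dot α else ddot α)
  else if symbol α (half x) = some s then half x else half' x

/-- `l^{α,t}_w = l^{α,t}_{w₁} ∘ ⋯ ∘ l^{α,t}_{wₙ}` for a word `w = w₁ ⋯ wₙ`. -/
noncomputable def branchWord (α : Angle) (t : Fin 2) (w : List (Fin 2)) (x : Angle) : Angle :=
  w.foldr (branch α t) x

/-- The length of the chord `S^{α,t}_w`, the image under `l^{α,t}_w` of the chord with endpoints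
`α̇` and `α̈`; it is measured by the distance of the endpoints on the circle of length one. -/
noncomputable def chordLength (α : Angle) (t : Fin 2) (w : List (Fin 2)) : ℝ :=
  dist (branchWord α t w (dot α)) (branchWord α t w (ddot α))

open Classical in
/-- The characteristic symbol `e^α`: the symbol `t` for which the chord `S^{α,t}_{0v}`,
`v = v^α`, is shorter than `1/4`. (With a diameter, the chords for `t = 0` and `t = 1` form
a triangle, and for a nonzero periodic `α` exactly one of the two is shorter than `1/4`.) -/
noncomputable def charSymbol (α : Angle) : Fin 2 :=
  if chordLength α 0 (0 :: repetitionWord α) < 1 / 4 then 0 else 1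

/-! ### The scanning algorithm -/

/-- The symbols of `s` at the places `i, …, i + |v|` form one of the blocks `0v`, `1v`. -/
def IsBlock (v : List (Fin 2)) (s : ℕ → Fin 2) (i : ℕ) : Prop :=
  ∀ (k : ℕ) (hk : k < v.length), s (i + 1 + k) = v[k]

/-- A state of the algorithm: the current position, the starting places of the blocks of
the run of consecutive blocks that is being read (the last one first), and the starting places of
the blocks that have been swapped so far. -/
structure State where
  pos : ℕ
  run : List ℕ
  swapped : Set ℕ

/-- Tracing back, at a position `i` that is preceded by the blocks in the list. If there is
a previous block and the symbol at `i` is `e`, stop: all the previous blocks are to be swapped. If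
the symbol is not `e`, go back to the start of the previous block and repeat. If there is no
previous block, stop: nothing is to be swapped. The result is the position where this stops, with
the list of the blocks to be swapped. -/
def traceBack (e : Fin 2) (s : ℕ → Fin 2) : ℕ → List ℕ → ℕ × List ℕ
  | i, [] => (i, [])
  | i, b :: bs => if s i = e then (i, b :: bs) else traceBack e s b bs

open Classical in
/-- One step of the algorithm. If there is a block at the current position, move past it. If not,
the run of blocks has ended: trace back, swap the blocks that tracing back has found, and slide by
one symbol from the position where it stopped. -/
noncomputable def step (v : List (Fin 2)) (e : Fin 2) (s : ℕ → Fin 2) (σ : State) : State :=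
  if IsBlock v s σ.pos then
    ⟨σ.pos + (v.length + 1), σ.pos :: σ.run, σ.swapped⟩
  else
    ⟨(traceBack e s σ.pos σ.run).1 + 1, [],
      σ.swapped ∪ {j | j ∈ (traceBack e s σ.pos σ.run).2}⟩

/-- The state after `t` steps, starting at position `0`. -/
noncomputable def stateAt (v : List (Fin 2)) (e : Fin 2) (s : ℕ → Fin 2) (t : ℕ) : State :=
  (step v e s)^[t] ⟨0, [], ∅⟩

/-- The block that starts at `j` is swapped in the course of the algorithm: either at some finite
time, or because it belongs to a run of blocks that never ends (such a tail of consecutive blocks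
is swapped as a whole). -/
def IsSwapped (v : List (Fin 2)) (e : Fin 2) (s : ℕ → Fin 2) (j : ℕ) : Prop :=
  (∃ t, j ∈ (stateAt v e s t).swapped) ∨ ∃ t₀, ∀ t ≥ t₀, j ∈ (stateAt v e s t).run

open Classical in
/-- The output of the algorithm with word `v` and symbol `e` on the sequence `s`. Swapping `0v` and
`1v` at `j` means replacing the symbol at `j` by the other one. -/
noncomputable def scan (v : List (Fin 2)) (e : Fin 2) (s : ℕ → Fin 2) (j : ℕ) : Fin 2 :=
  if IsSwapped v e s j then 1 - s j else s j

/-- The map `φ_α` on `0`-`1` sequences. -/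
noncomputable def phi (α : Angle) (s : ℕ → Fin 2) : ℕ → Fin 2 :=
  scan (repetitionWord α) (charSymbol α) s

end Narrow

/-! Write h for `double`, n for the period of α, and l = 1/(2^n - 1). Replacing the diameter over α
by the one over β changes the symbol of y exactly when h(y) lies in the open arc (α, β)
(`NarrowPair.symbol_right`). So the two itineraries of θ differ at j iff F(j) holds: h^(j+1)(θ) lies
in the arc. It remains to show that the algorithm swaps exactly where F holds.

Narrowness gives 2^(n-1) l = 1/2 + l/2: h^(n-1) maps the arc injectively onto the half circle that
starts at α̇, whose symbol is e, followed by a short arc that h maps onto (α, β). The portrait keeps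
the earlier images of the arc off the diameter through α̇, so every point of the arc starts with v.
Hence F(j) holds iff there is a block at j and s_(j+n) = e or F(j+n) (`NarrowPair.inArc_iff`).
Places of F are at least n apart (`NarrowPair.not_inArc_iterate`). Tracing back solves this
recursion from the end of a finite run (`isSwapped_iff`).

On an infinite run the recursion alone does not decide F. If F failed there, an iterate of θ would
share all half circles with α. Classes of such points are unlinked, and h preserves cyclic order on
each. In the class of α, the points fixed by h^n are β or lie on the orbit of α
(`NarrowPair.eq_of_sameSide`); any other member avoiding α moves monotonically under h^n, and
expansion forces it onto a fixed point of h^n (`NarrowPair.exists_iterate_fixed`). Then θ would be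
precritical for α or β. -/

namespace Narrow

/-! ### The scanning algorithm, for an abstract set of marked blocks -/

/-- The starting places `b, b + n, …, b + (m - 1) n` of `m` consecutive blocks of length `n`,
the last one first. -/
def runList (n b : ℕ) : ℕ → List ℕ
  | 0 => []
  | m + 1 => (b + m * n) :: runList n b m

theorem mem_runList {n b m i : ℕ} : i ∈ runList n b m ↔ ∃ k < m, i = b + k * n := by
  induction m with
  | zero => simp [runList]
  | succ m ih =>
    rw [runList, List.mem_cons, ih]
    constructor
    · rintro (h | ⟨k, hk, h⟩)
      · exact ⟨m, by omega, h⟩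
      · exact ⟨k, by omega, h⟩
    · rintro ⟨k, hk, h⟩
      rcases Nat.lt_succ_iff_lt_or_eq.mp hk with h' | rfl
      · exact Or.inr ⟨k, h', h⟩
      · exact Or.inl h

section scan

variable {v : List (Fin 2)} {e : Fin 2} {s : ℕ → Fin 2} {F : ℕ → Prop}

/-- The state of the algorithm is correct when the current run consists of `m` blocks and starts
at `b`, and the blocks swapped so far are those before `b` that satisfy `F`. -/
structure Correct (v : List (Fin 2)) (s : ℕ → Fin 2) (F : ℕ → Prop) (b m : ℕ) (σ : State) :
    Prop where
  pos : σ.pos = b + m * (v.length + 1)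
  run : σ.run = runList (v.length + 1) b m
  block : ∀ k < m, IsBlock v s (b + k * (v.length + 1))
  swapped : ∀ j, j ∈ σ.swapped ↔ j < b ∧ F j

/-- Failure of F at a place where the symbol is not e passes to the block before it. Once the symbol
is e, F holds at the preceding block and spreads back over the whole run. So the trace stops at a
place where F fails, preceded only by blocks with F. -/
theorem traceBack_runList
    (hF : ∀ j, F j ↔ IsBlock v s j ∧ (s (j + (v.length + 1)) = e ∨ F (j + (v.length + 1))))
    (b m : ℕ) (hblock : ∀ k < m, IsBlock v s (b + k * (v.length + 1)))
    (hm : ¬ F (b + m * (v.length + 1))) :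
    ∃ m' ≤ m, traceBack e s (b + m * (v.length + 1)) (runList (v.length + 1) b m) =
        (b + m' * (v.length + 1), runList (v.length + 1) b m') ∧
      ¬ F (b + m' * (v.length + 1)) ∧ ∀ k < m', F (b + k * (v.length + 1)) := by
  have hnext : ∀ k, b + k * (v.length + 1) + (v.length + 1) = b + (k + 1) * (v.length + 1) := by
    intro k; ring
  induction m with
  | zero => exact ⟨0, le_rfl, rfl, hm, by simp⟩
  | succ m ih =>
    by_cases he : s (b + (m + 1) * (v.length + 1)) = e
    · refine ⟨m + 1, le_rfl, ?_, hm, ?_⟩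
      · simp [runList, traceBack, he]
      · have key : ∀ d k, k + d = m → F (b + k * (v.length + 1)) := by
          intro d
          induction d with
          | zero =>
            intro k hk
            obtain rfl : k = m := by omega
            exact (hF _).2 ⟨hblock _ (by omega), Or.inl (by rw [hnext]; exact he)⟩
          | succ d ihd =>
            intro k hk
            exact (hF _).2 ⟨hblock _ (by omega), Or.inr (by rw [hnext]; exact ihd _ (by omega))⟩
        intro k hk
        exact key (m - k) k (by omega)
    · have hm' : ¬ F (b + m * (v.length + 1)) := by
        rw [hF, hnext]
        rintro ⟨-, h | h⟩
        · exact he h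
        · exact hm h
      obtain ⟨m', h1, h2, h3, h4⟩ := ih (fun k hk => hblock k (by omega)) hm'
      refine ⟨m', by omega, ?_, h3, h4⟩
      rw [← h2]
      simp [runList, traceBack, he]

theorem Correct.step_of_block {b m : ℕ} {σ : State} (h : Correct v s F b m σ)
    (hb : IsBlock v s σ.pos) : Correct v s F b (m + 1) (step v e s σ) := by
  rw [step, if_pos hb]
  refine ⟨?_, ?_, ?_, h.swapped⟩
  · simp only [h.pos]; ring
  · simp only [h.run, h.pos, runList]
  · intro k hk
    rcases Nat.lt_succ_iff_lt_or_eq.mp hk with h' | rfl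
    · exact h.block k h'
    · rw [← h.pos]; exact hb

/-- The new start is one past a place where F fails. Below it, a place of F is before b, or starts a
remaining block, or lies strictly inside one; `hdisj` excludes the last case. -/
theorem Correct.step_of_not_block
    (hF : ∀ j, F j ↔ IsBlock v s j ∧ (s (j + (v.length + 1)) = e ∨ F (j + (v.length + 1))))
    (hdisj : ∀ j i, 0 < i → i < v.length + 1 → F j → ¬ F (j + i))
    {b m : ℕ} {σ : State} (h : Correct v s F b m σ) (hb : ¬ IsBlock v s σ.pos) :
    ∃ b' > b, Correct v s F b' 0 (step v e s σ) := by
  have hm : ¬ F (b + m * (v.length + 1)) := by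
    rw [hF, ← h.pos]; exact fun h' => hb h'.1
  obtain ⟨m', -, htb, hm', hlt⟩ := traceBack_runList hF b m h.block hm
  refine ⟨b + m' * (v.length + 1) + 1, ?_, ?_⟩
  · have := Nat.zero_le (m' * (v.length + 1)); omega
  rw [step, if_neg hb, h.pos, h.run, htb]
  refine ⟨by simp, rfl, by simp, ?_⟩
  intro j
  simp only [Set.mem_union, Set.mem_ofPred_eq, h.swapped, mem_runList]
  constructor
  · rintro (⟨h1, h2⟩ | ⟨k, hk, rfl⟩)
    · exact ⟨by have := Nat.zero_le (m' * (v.length + 1)); omega, h2⟩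
    · refine ⟨?_, hlt k hk⟩
      have := Nat.mul_le_mul_right (v.length + 1) hk.le
      omega
  · rintro ⟨h1, h2⟩
    by_cases hjb : j < b
    · exact Or.inl ⟨hjb, h2⟩
    right
    obtain ⟨i, rfl⟩ := Nat.exists_eq_add_of_le (not_lt.mp hjb)
    have hi : i = i / (v.length + 1) * (v.length + 1) + i % (v.length + 1) := by
      rw [mul_comm]; exact (Nat.div_add_mod _ _).symm
    have hr : i % (v.length + 1) < v.length + 1 := Nat.mod_lt _ (by omega)
    generalize i / (v.length + 1) = k at hi
    generalize i % (v.length + 1) = r at hi hr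
    subst hi
    have hk : k ≤ m' := by
      by_contra! hk
      have := Nat.mul_le_mul_right (v.length + 1) hk
      rw [Nat.succ_mul] at this
      omega
    rcases Nat.eq_zero_or_pos r with rfl | hr0
    · rcases hk.lt_or_eq with hk | rfl
      · exact ⟨k, hk, by simp⟩
      · exact absurd h2 hm'
    · rcases hk.lt_or_eq with hk | rfl
      · exact absurd h2 (by rw [← add_assoc]; exact hdisj _ _ hr0 hr (hlt k hk))
      · omega

theorem stateAt_succ (t : ℕ) : stateAt v e s (t + 1) = step v e s (stateAt v e s t) :=
  Function.iterate_succ_apply' _ _ _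

/-- The algorithm swaps exactly the blocks with the property `F`, if `F` can be read off from the
next place, cannot hold at two overlapping blocks, and holds along runs that never end. -/
theorem isSwapped_iff
    (hF : ∀ j, F j ↔ IsBlock v s j ∧ (s (j + (v.length + 1)) = e ∨ F (j + (v.length + 1))))
    (hdisj : ∀ j i, 0 < i → i < v.length + 1 → F j → ¬ F (j + i))
    (hinf : ∀ j, (∀ k, IsBlock v s (j + k * (v.length + 1))) → F j) (j : ℕ) :
    IsSwapped v e s j ↔ F j := by
  have hstep : ∀ {b m t}, Correct v s F b m (stateAt v e s t) →
      ∃ b' ≥ b, ∃ m', Correct v s F b' m' (stateAt v e s (t + 1)) := by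
    intro b m t h
    rw [stateAt_succ]
    by_cases hb : IsBlock v s (stateAt v e s t).pos
    · exact ⟨b, le_rfl, _, h.step_of_block hb⟩
    · obtain ⟨b', hb', h'⟩ := h.step_of_not_block hF hdisj hb
      exact ⟨b', hb'.le, 0, h'⟩
  have hmono : ∀ {b m t} (k), Correct v s F b m (stateAt v e s t) →
      ∃ b' ≥ b, ∃ m', Correct v s F b' m' (stateAt v e s (t + k)) := by
    intro b m t k h
    induction k with
    | zero => exact ⟨b, le_rfl, m, h⟩
    | succ k ih =>
      obtain ⟨b', hb', m', h'⟩ := ih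
      obtain ⟨b'', hb'', m'', h''⟩ := hstep h'
      exact ⟨b'', hb'.trans hb'', m'', h''⟩
  have h0 : Correct v s F 0 0 (stateAt v e s 0) :=
    ⟨by simp [stateAt], by simp [stateAt, runList], by simp, by simp [stateAt]⟩
  have hall : ∀ t, ∃ b m, Correct v s F b m (stateAt v e s t) := by
    intro t
    obtain ⟨b, -, m, h⟩ := hmono t h0
    rw [zero_add] at h
    exact ⟨b, m, h⟩
  have hsound : (∃ t, j ∈ (stateAt v e s t).swapped) → F j := by
    rintro ⟨t, ht⟩
    obtain ⟨b, m, h⟩ := hall t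
    exact ((h.swapped j).1 ht).2
  -- Either one final run never ends, or slides recur forever and every place is decided at a finite
  -- time.
  by_cases hcase : ∃ t₀, ∀ t ≥ t₀, IsBlock v s (stateAt v e s t).pos
  · obtain ⟨t₀, ht₀⟩ := hcase
    obtain ⟨b, m, h⟩ := hall t₀
    have hrun : ∀ k, Correct v s F b (m + k) (stateAt v e s (t₀ + k)) := by
      intro k
      induction k with
      | zero => exact h
      | succ k ih =>
        rw [← add_assoc, ← add_assoc, stateAt_succ]
        exact ih.step_of_block (ht₀ _ (by omega))
    have hblock : ∀ k, IsBlock v s (b + k * (v.length + 1)) := fun k =>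
      (hrun (k + 1)).block k (by omega)
    have hFb : ∀ k, F (b + k * (v.length + 1)) := by
      intro k
      refine hinf _ fun l => ?_
      have := hblock (k + l)
      rwa [add_mul, ← add_assoc] at this
    constructor
    · rintro (h' | ⟨t₁, ht₁⟩)
      · exact hsound h'
      · have := ht₁ (t₀ + t₁) (by omega)
        rw [(hrun t₁).run, mem_runList] at this
        obtain ⟨k, -, rfl⟩ := this
        exact hFb k
    · intro hj
      by_cases hjb : j < b
      · exact Or.inl ⟨t₀, (h.swapped j).2 ⟨hjb, hj⟩⟩
      right
      obtain ⟨i, rfl⟩ := Nat.exists_eq_add_of_le (not_lt.mp hjb)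
      have hi : i = i / (v.length + 1) * (v.length + 1) + i % (v.length + 1) := by
        rw [mul_comm]; exact (Nat.div_add_mod _ _).symm
      have hr : i % (v.length + 1) < v.length + 1 := Nat.mod_lt _ (by omega)
      generalize i / (v.length + 1) = k at hi
      generalize i % (v.length + 1) = r at hi hr
      subst hi
      rcases Nat.eq_zero_or_pos r with rfl | hr0
      · refine ⟨t₀ + (k + 1), fun t ht => ?_⟩
        obtain ⟨l, rfl⟩ := Nat.exists_eq_add_of_le ht
        rw [add_assoc t₀, (hrun _).run, mem_runList]
        exact ⟨k, by omega, by simp⟩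
      · exact absurd hj (by rw [← add_assoc]; exact hdisj _ _ hr0 hr (hFb k))
  · push Not at hcase
    constructor
    · rintro (h' | ⟨t₁, ht₁⟩)
      · exact hsound h'
      · obtain ⟨t, ht, hb⟩ := hcase t₁
        obtain ⟨b, m, h⟩ := hall t
        obtain ⟨b', -, h'⟩ := h.step_of_not_block hF hdisj hb
        have := ht₁ (t + 1) (by omega)
        rw [stateAt_succ, h'.run] at this
        simp [runList] at this
    · intro hj
      -- Each slide strictly increases the start b of the run, so b eventually passes j.
      have hlarge : ∀ B, ∃ t, ∃ b ≥ B, ∃ m, Correct v s F b m (stateAt v e s t) := by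
        intro B
        induction B with
        | zero => exact ⟨0, 0, le_rfl, 0, h0⟩
        | succ B ih =>
          obtain ⟨t, b, hb, m, h⟩ := ih
          obtain ⟨t', ht', hnb⟩ := hcase t
          obtain ⟨k, rfl⟩ := Nat.exists_eq_add_of_le ht'
          obtain ⟨b', hb', m', h'⟩ := hmono k h
          obtain ⟨b'', hb'', h''⟩ := h'.step_of_not_block hF hdisj hnb
          exact ⟨t + k + 1, b'', by omega, 0, by rw [stateAt_succ]; exact h''⟩
      obtain ⟨t, b, hb, m, h⟩ := hlarge (j + 1)
      exact Or.inl ⟨t, (h.swapped j).2 ⟨by omega, hj⟩⟩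

end scan

/-! ### Arc lengths -/

theorem arcLength_nonneg (x y : Angle) : 0 ≤ arcLength x y :=
  (AddCircle.equivIco (1 : ℝ) 0 (y - x)).2.1

theorem arcLength_lt_one (x y : Angle) : arcLength x y < 1 := 
  lt_of_lt_of_eq (AddCircle.equivIco (1 : ℝ) 0 (y - x)).2.2 (zero_add 1)

theorem coe_arcLength (x y : Angle) : ((arcLength x y : ℝ) : Angle) = y - x :=
  AddCircle.coe_equivIco

theorem arcLength_eq {x y : Angle} {r : ℝ} (h0 : 0 ≤ r) (h1 : r < 1)
    (h : (r : Angle) = y - x) : arcLength x y = r := by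
  rw [arcLength, ← h, AddCircle.equivIco_coe_of_mem ⟨h0, by simpa using h1⟩]

theorem add_arcLength (x y : Angle) : x + ((arcLength x y : ℝ) : Angle) = y := by
  rw [coe_arcLength]; abel

@[simp] theorem arcLength_self (x : Angle) : arcLength x x = 0 :=
  arcLength_eq le_rfl one_pos (by simp)

theorem arcLength_eq_zero {x y : Angle} : arcLength x y = 0 ↔ x = y := by
  constructor
  · intro h
    have := add_arcLength x y
    rwa [h, AddCircle.coe_zero, add_zero] at this
  · rintro rfl; simp

theorem arcLength_pos {x y : Angle} (h : x ≠ y) : 0 < arcLength x y :=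
  lt_of_le_of_ne (arcLength_nonneg _ _) fun h' => h (arcLength_eq_zero.1 h'.symm)

theorem coe_one_angle : ((1 : ℝ) : Angle) = 0 := AddCircle.coe_period 1

/-- Here and in the next three lemmas the circle is cut at b; a full turn is added when the arc
crosses the cut. They turn cyclic order arguments into linear arithmetic. -/
theorem arcLength_of_le {b y z : Angle} (h : arcLength b y ≤ arcLength b z) :
    arcLength y z = arcLength b z - arcLength b y := by
  have h1 := arcLength_nonneg b y
  have h2 := arcLength_lt_one b z
  refine arcLength_eq (by linarith) (by linarith) ?_
  rw [AddCircle.coe_sub, coe_arcLength, coe_arcLength]; abel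

theorem arcLength_of_lt {b y z : Angle} (h : arcLength b z < arcLength b y) :
    arcLength y z = arcLength b z - arcLength b y + 1 := by
  have h1 := arcLength_nonneg b z
  have h2 := arcLength_lt_one b y
  refine arcLength_eq (by linarith) (by linarith) ?_
  rw [AddCircle.coe_add, AddCircle.coe_sub, coe_arcLength, coe_arcLength, coe_one_angle]; abel

theorem arcLength_of_ge {b y z : Angle} (h : arcLength z b ≤ arcLength y b) :
    arcLength y z = arcLength y b - arcLength z b := by
  have h1 := arcLength_nonneg z b
  have h2 := arcLength_lt_one y b
  refine arcLength_eq (by linarith) (by linarith) ?_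
  rw [AddCircle.coe_sub, coe_arcLength, coe_arcLength]; abel

theorem arcLength_of_gt {b y z : Angle} (h : arcLength y b < arcLength z b) :
    arcLength y z = arcLength y b - arcLength z b + 1 := by
  have h1 := arcLength_nonneg y b
  have h2 := arcLength_lt_one z b
  refine arcLength_eq (by linarith) (by linarith) ?_
  rw [AddCircle.coe_add, AddCircle.coe_sub, coe_arcLength, coe_arcLength, coe_one_angle]; abel

theorem arcLength_comm {x y : Angle} (h : x ≠ y) : arcLength y x = 1 - arcLength x y := by
  rw [arcLength_of_lt (b := x) (by simpa using arcLength_pos h), arcLength_self]; ring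

theorem arcLength_right_injective {b y z : Angle} (h : arcLength b y = arcLength b z) : y = z := by
  rw [← add_arcLength b y, h, add_arcLength]

theorem arcLength_left_injective {b y z : Angle} (h : arcLength y b = arcLength z b) : y = z := by
  rw [← arcLength_eq_zero, arcLength_of_ge h.ge, h, sub_self]

theorem sbtw_iff_arcLength {a b c : Angle} :
    sbtw a b c ↔ 0 < arcLength a b ∧ arcLength a b < arcLength a c := by
  obtain ⟨a, rfl⟩ := QuotientAddGroup.mk_surjective a
  have hb := add_arcLength (a : Angle) b
  have hc := add_arcLength (a : Angle) c
  have hb0 := arcLength_nonneg (a : Angle) b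
  have hb1 := arcLength_lt_one (a : Angle) b
  have hc0 := arcLength_nonneg (a : Angle) c
  have hc1 := arcLength_lt_one (a : Angle) c
  change _ ↔ 0 < arcLength (a : Angle) b ∧ arcLength (a : Angle) b < arcLength (a : Angle) c
  generalize arcLength (a : Angle) b = r at *
  generalize arcLength (a : Angle) c = t at *
  rw [← AddCircle.coe_add] at hb hc
  subst hb hc
  rw [sbtw_iff_not_btw, btw_cyclic]
  refine (not_congr (QuotientAddGroup.btw_coe_iff (p := (1 : ℝ)) (x₁ := a) (x₂ := a + t)
    (x₃ := a + r))).trans ?_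
  have hp : (0 : ℝ) < 1 := one_pos
  rw [(toIcoMod_eq_self hp).2 (show a + t ∈ Set.Ico a (a + 1) from ⟨by linarith, by linarith⟩)]
  rcases hb0.eq_or_lt with h | h
  · subst h
    rw [add_zero, toIocMod_apply_left]
    simp only [lt_irrefl, false_and, iff_false, not_not]
    linarith
  · rw [(toIocMod_eq_self hp).2 (show a + r ∈ Set.Ioc a (a + 1) from ⟨by linarith, by linarith⟩)]
    simp [h]

/-! ### Doubling -/

theorem double_eq (x : Angle) : double x = x + x := two_nsmul x

theorem double_add (x y : Angle) : double (x + y) = double x + double y := by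
  simp only [double_eq]; abel

theorem iterate_double_add (k : ℕ) (x y : Angle) :
    double^[k] (x + y) = double^[k] x + double^[k] y := by
  induction k with
  | zero => rfl
  | succ k ih => rw [Function.iterate_succ_apply', ih, double_add,
      Function.iterate_succ_apply', Function.iterate_succ_apply']

theorem iterate_double_coe (k : ℕ) (r : ℝ) :
    double^[k] (r : Angle) = ((2 ^ k * r : ℝ) : Angle) := by
  induction k with
  | zero => simp
  | succ k ih =>
    rw [Function.iterate_succ_apply', ih, double_eq, ← AddCircle.coe_add]
    congr 1; ring

theorem double_coe (r : ℝ) : double (r : Angle) = ((2 * r : ℝ) : Angle) := by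
  simpa using iterate_double_coe 1 r

theorem coe_arcLength_double (x y : Angle) :
    ((2 * arcLength x y : ℝ) : Angle) = double y - double x := by
  rw [← double_coe, coe_arcLength, double_eq, double_eq, double_eq]; abel

theorem arcLength_double_of_lt {x y : Angle} (h : arcLength x y < 1 / 2) :
    arcLength (double x) (double y) = 2 * arcLength x y := by
  have := arcLength_nonneg x y
  exact arcLength_eq (by linarith) (by linarith) (coe_arcLength_double x y)

theorem arcLength_double_of_ge {x y : Angle} (h : 1 / 2 ≤ arcLength x y) :
    arcLength (double x) (double y) = 2 * arcLength x y - 1 := by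
  have := arcLength_lt_one x y
  refine arcLength_eq (by linarith) (by linarith) ?_
  rw [AddCircle.coe_sub, coe_arcLength_double, coe_one_angle, sub_zero]

theorem arcLength_iterate_double {x y : Angle} {k : ℕ} (h : 2 ^ k * arcLength x y < 1) :
    arcLength (double^[k] x) (double^[k] y) = 2 ^ k * arcLength x y := by
  have h0 := arcLength_nonneg x y
  refine arcLength_eq (by positivity) h ?_
  rw [← iterate_double_coe, coe_arcLength, eq_sub_iff_add_eq, ← iterate_double_add, sub_add_cancel]

theorem exists_int_arcLength_iterate_double (x y : Angle) (k : ℕ) :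
    ∃ m : ℤ, arcLength (double^[k] x) (double^[k] y) = 2 ^ k * arcLength x y - m := by
  have h : ((2 ^ k * arcLength x y - arcLength (double^[k] x) (double^[k] y) : ℝ) : Angle) = 0 := by
    rw [AddCircle.coe_sub, coe_arcLength, ← iterate_double_coe, coe_arcLength, sub_eq_zero,
      eq_sub_iff_add_eq, ← iterate_double_add, sub_add_cancel]
  obtain ⟨m, hm⟩ := (AddCircle.coe_eq_zero_iff (1 : ℝ)).1 h
  refine ⟨m, ?_⟩
  simp at hm
  linarith

/-- Two points with the same image under doubling are equal or antipodal. -/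
theorem arcLength_of_double_eq {x y : Angle} (h : double x = double y) (hxy : x ≠ y) :
    arcLength x y = 1 / 2 := by
  have h0 := arcLength_pos hxy
  have h1 := arcLength_lt_one x y
  by_cases hlt : arcLength x y < 1 / 2
  · have := arcLength_double_of_lt hlt
    rw [h, arcLength_self] at this
    linarith
  · have := arcLength_double_of_ge (not_lt.1 hlt)
    rw [h, arcLength_self] at this
    linarith

/-! ### Points fixed by an iterate of doubling -/

theorem iterate_comm (k l : ℕ) (x : Angle) :
    double^[k] (double^[l] x) = double^[l] (double^[k] x) := by
  rw [← Function.iterate_add_apply, ← Function.iterate_add_apply, add_comm]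

theorem iterate_fixed {n : ℕ} {x : Angle} (hx : double^[n] x = x) (k : ℕ) :
    double^[n] (double^[k] x) = double^[k] x := by
  rw [iterate_comm, hx]

theorem four_le_two_pow {n : ℕ} (hn : 2 ≤ n) : (4 : ℝ) ≤ 2 ^ n := by
  calc (4 : ℝ) = 2 ^ 2 := by norm_num
    _ ≤ 2 ^ n := pow_le_pow_right₀ (by norm_num) hn

/-- The difference of two fixed points of h^n is killed by 2^n - 1. This discreteness makes l the
least distance between such points and lets shortest arcs be chosen by `Nat.find`. -/
theorem exists_nat_mul_arcLength {n : ℕ} {y z : Angle} (hy : double^[n] y = y)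
    (hz : double^[n] z = z) : ∃ m : ℕ, ((2 : ℝ) ^ n - 1) * arcLength y z = m := by
  obtain ⟨m, hm⟩ := exists_int_arcLength_iterate_double y z n
  rw [hy, hz] at hm
  have h0 : (0 : ℝ) ≤ (2 ^ n - 1) * arcLength y z :=
    mul_nonneg (by linarith [one_le_pow₀ (M₀ := ℝ) (n := n) one_le_two]) (arcLength_nonneg _ _)
  have h1 : ((2 : ℝ) ^ n - 1) * arcLength y z = m := by linarith
  have : (0 : ℤ) ≤ m := by rw [h1] at h0; exact_mod_cast h0
  lift m to ℕ using this
  exact ⟨m, by simpa using h1⟩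

theorem arcLength_ge_of_fixed {n : ℕ} (hn : 2 ≤ n) {y z : Angle} (hy : double^[n] y = y)
    (hz : double^[n] z = z) (hne : y ≠ z) : 1 / ((2 : ℝ) ^ n - 1) ≤ arcLength y z := by
  have h4 := four_le_two_pow hn
  obtain ⟨m, hm⟩ := exists_nat_mul_arcLength hy hz
  have hpos := arcLength_pos hne
  have : (0 : ℝ) < m := by rw [← hm]; apply mul_pos <;> linarith
  have : (1 : ℝ) ≤ m := by exact_mod_cast this
  rw [div_le_iff₀ (by linarith)]
  linarith

/-- The arc between two fixed points of `double^[n]` is at most the largest multiple of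
`1 / (2 ^ n - 1)` below `1 / 2`, if it is shorter than a half circle or equal to it. -/
theorem arcLength_le_of_fixed {n : ℕ} (hn : 2 ≤ n) {y z : Angle} (hy : double^[n] y = y)
    (hz : double^[n] z = z) (h : arcLength y z ≤ 1 / 2) :
    arcLength y z ≤ 1 / 2 - 1 / ((2 : ℝ) ^ n - 1) / 2 := by
  have h4 := four_le_two_pow hn
  obtain ⟨m, hm⟩ := exists_nat_mul_arcLength hy hz
  obtain ⟨k, rfl⟩ : ∃ k, n = k + 1 := ⟨n - 1, by omega⟩
  have h2 : (2 * m : ℝ) ≤ 2 ^ (k + 1) - 1 := by rw [← hm]; nlinarith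
  have h3 : 2 * m + 1 ≤ 2 ^ (k + 1) := by
    have : ((2 * m + 1 : ℕ) : ℝ) ≤ ((2 ^ (k + 1) : ℕ) : ℝ) := by push_cast; linarith
    exact_mod_cast this
  -- The left side of `h3` is odd and the right side even.
  have h5 : 2 * m + 2 ≤ 2 ^ (k + 1) := by rw [pow_succ] at h3 ⊢; omega
  have h6 : (2 * m + 2 : ℝ) ≤ 2 ^ (k + 1) := by exact_mod_cast h5
  have hq : (0 : ℝ) < 2 ^ (k + 1) - 1 := by linarith
  have e1 : arcLength y z = m / (2 ^ (k + 1) - 1) := by field_simp; linarith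
  rw [e1, div_div, mul_comm, ← div_div, div_le_iff₀ hq]
  field_simp
  linarith

/-! ### The two half circles -/

/-- The half circle of the points from which the positively oriented arc to `a` is not shorter
than `1 / 2`. -/
def Upper (a y : Angle) : Prop := 1 / 2 ≤ arcLength y a

/-- A pair of angles of period `n` that bounds an arc of length `1 / (2 ^ n - 1)`, such that
the iterates of the two angles are not separated by the diameter through the preimages of the
first angle. -/
structure NarrowPair (n : ℕ) (α β : Angle) : Prop where
  two_le : 2 ≤ n
  iterate_left : double^[n] α = α
  iterate_right : double^[n] β = β
  ne_left : ∀ k, 0 < k → k < n → double^[k] α ≠ α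
  ne_right : ∀ k, 0 < k → k < n → double^[k] β ≠ β
  length : arcLength α β = 1 / ((2 : ℝ) ^ n - 1)
  same_side : ∀ k < n, Upper (double^[n - 1] α) (double^[k] α) ↔
    Upper (double^[n - 1] α) (double^[k] β)

/-! ### From orbit portraits to narrow pairs -/

theorem IsOrbitPortrait.iterate_mem {p : ℕ} {O : ZMod p → Finset Angle} (h : IsOrbitPortrait p O)
    {j : ZMod p} {a : Angle} (ha : a ∈ O j) (k : ℕ) : double^[k] a ∈ O (j + k) := by
  induction k with
  | zero => simpa using ha
  | succ k ih =>
    rw [Function.iterate_succ_apply', Nat.cast_succ, ← add_assoc]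
    exact (h.bijOn _).mapsTo ih

theorem IsOrbitPortrait.iterate_sbtw {p : ℕ} {O : ZMod p → Finset Angle}
    (h : IsOrbitPortrait p O) {j : ZMod p} {a b c : Angle} (ha : a ∈ O j) (hb : b ∈ O j)
    (hc : c ∈ O j) (habc : sbtw a b c) (k : ℕ) :
    sbtw (double^[k] a) (double^[k] b) (double^[k] c) := by
  induction k with
  | zero => exact habc
  | succ k ih =>
    rw [Function.iterate_succ_apply', Function.iterate_succ_apply', Function.iterate_succ_apply']
    exact h.cyclic _ _ (h.iterate_mem ha k) _ (h.iterate_mem hb k) _ (h.iterate_mem hc k) ih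

theorem iterate_ne_of_fixed {n : ℕ} {x : Angle} (hn : 0 < n) (hx : double^[n] x = x)
    (hne : ∀ k, 0 < k → k < n → double^[k] x ≠ x) {k : ℕ} (hk : k < n - 1) :
    double^[k] x ≠ double^[n - 1] x := by
  intro h
  apply hne (k + 1) (by omega) (by omega)
  have := congrArg double h
  rw [← Function.iterate_succ_apply' double, ← Function.iterate_succ_apply' double] at this
  rw [this, Nat.succ_eq_add_one, Nat.sub_add_cancel hn, hx]

/-- The diameter at α̇ = a nearly agrees with the chord from a to b = h^(n-1)(β): no fixed point of
h^n lies between b and the antipode of a. So if the diameter separated h^k(α) from h^k(β), their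
chord would cross the chord ab, which the portrait forbids. -/
theorem IsNarrowArc.narrowPair {α β : Angle} (h : IsNarrowArc α β) :
    NarrowPair (period α) α β ∧ period β = period α := by
  obtain ⟨⟨p, O, hO, ⟨j, hα, hβ, hαβ, -⟩, -⟩, hlen⟩ := h
  obtain ⟨r, hr, hper⟩ := hO.periodic
  have hβα : period β = period α := (hper j β hβ).trans (hper j α hα).symm
  have hn0 : 0 < period α := by rw [hper j α hα]; exact Nat.mul_pos hr hO.pos
  have itα : double^[period α] α = α := Function.iterate_minimalPeriod
  have itβ : double^[period α] β = β := hβα ▸ Function.iterate_minimalPeriod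
  have neα : ∀ k, 0 < k → k < period α → double^[k] α ≠ α := fun k h0 hk hfix =>
    Function.not_isPeriodicPt_of_pos_of_lt_minimalPeriod h0.ne' hk hfix
  have neβ : ∀ k, 0 < k → k < period α → double^[k] β ≠ β := fun k h0 hk hfix =>
    Function.not_isPeriodicPt_of_pos_of_lt_minimalPeriod h0.ne' (hk.trans_eq hβα.symm) hfix
  generalize period α = n at *
  -- For n = 1 the arc would have length 1.
  have hn : 2 ≤ n := by
    by_contra! hn
    obtain rfl : n = 1 := by omega
    have := arcLength_lt_one α β
    rw [hlen] at this
    norm_num at this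
  refine ⟨⟨hn, itα, itβ, neα, neβ, hlen, ?_⟩, hβα⟩
  have h4 := four_le_two_pow hn
  have hq : (0 : ℝ) < 2 ^ n - 1 := by linarith
  set l : ℝ := 1 / ((2 : ℝ) ^ n - 1) with hl
  have hl0 : 0 < l := by positivity
  have hql : (2 : ℝ) ^ n * l = 1 + l := by rw [hl]; field_simp; ring
  have hl3 : l ≤ 1 / 3 := by nlinarith
  have h2n : (2 : ℝ) ^ n = 2 * 2 ^ (n - 1) := by
    rw [← pow_succ']; congr 1; omega
  have hB : arcLength (double^[n - 1] α) (double^[n - 1] β) = 1 / 2 + l / 2 := by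
    have : (2 : ℝ) ^ (n - 1) * l = 1 / 2 + l / 2 := by rw [h2n] at hql; linarith
    rw [arcLength_iterate_double, hlen, this]
    rw [hlen, this]; linarith
  have hne : double^[n - 1] α ≠ double^[n - 1] β := by
    intro h'; rw [h', arcLength_self] at hB; linarith
  intro k hk
  rcases Nat.lt_or_ge k (n - 1) with hk1 | hk1
  swap
  · obtain rfl : k = n - 1 := by omega
    rw [Upper, Upper, arcLength_comm hne, hB, arcLength_self]
    constructor <;> intro <;> linarith
  set a := double^[n - 1] α with ha
  set b := double^[n - 1] β with hb
  set x := double^[k] α with hx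
  set y := double^[k] β with hy
  have fa : double^[n] a = a := iterate_fixed itα _
  have fb : double^[n] b = b := iterate_fixed itβ _
  have fx : double^[n] x = x := iterate_fixed itα _
  have fy : double^[n] y = y := iterate_fixed itβ _
  have hxa : x ≠ a := iterate_ne_of_fixed hn0 itα neα hk1
  have hyb : y ≠ b := iterate_ne_of_fixed hn0 itβ neβ hk1
  have hk4 : (2 : ℝ) ^ k * 4 ≤ 2 ^ n := by
    calc (2 : ℝ) ^ k * 4 = 2 ^ (k + 2) := by ring
      _ ≤ 2 ^ n := pow_le_pow_right₀ (by norm_num) (by omega)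
  have hA4 : (2 : ℝ) ^ k * l ≤ (1 + l) / 4 := by nlinarith
  have hA : arcLength x y = 2 ^ k * l := by
    rw [hx, hy, arcLength_iterate_double, hlen]
    rw [hlen]; linarith
  have hA0 : 0 < arcLength x y := by rw [hA]; positivity
  rw [← hA] at hA4
  -- a crossing of the chords `x y` and `a b` is impossible
  have key : ∀ w w' : Angle, (w = a ∧ w' = b ∨ w = b ∧ w' = a) → sbtw x w y →
      sbtw y w' x → False := by
    intro w w' hw h1 h2
    have hxO : x ∈ O (j + k) := hO.iterate_mem hα k
    have hyO : y ∈ O (j + k) := hO.iterate_mem hβ k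
    have haO : a ∈ O (j + (n - 1 : ℕ)) := hO.iterate_mem hα _
    have hbO : b ∈ O (j + (n - 1 : ℕ)) := hO.iterate_mem hβ _
    have hwO : w ∈ O (j + (n - 1 : ℕ)) := by rcases hw with ⟨rfl, -⟩ | ⟨rfl, -⟩ <;> assumption
    have hwO' : w' ∈ O (j + (n - 1 : ℕ)) := by rcases hw with ⟨-, rfl⟩ | ⟨-, rfl⟩ <;> assumption
    have fw : double^[n] w = w := by rcases hw with ⟨rfl, -⟩ | ⟨rfl, -⟩ <;> assumption
    -- Within one member of the portrait crossing chords are allowed, but n - k more steps preserve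
    -- the cyclic order and put a fixed point of h^n inside the arc from α to β, closer to α than l.
    by_cases hij : j + (k : ZMod p) = j + (n - 1 : ℕ)
    · rw [← hij] at hwO
      have := hO.iterate_sbtw hxO hwO hyO h1 (n - k)
      rw [hx, hy, ← Function.iterate_add_apply, ← Function.iterate_add_apply,
        Nat.sub_add_cancel hk.le, itα, itβ, sbtw_iff_arcLength, hlen] at this
      have h3 := arcLength_ge_of_fixed hn itα (iterate_fixed fw (n - k))
        (fun h' => by rw [← h', arcLength_self] at this; exact lt_irrefl _ this.1)
      linarith
    · exact (hO.unlinked _ _ hij).2 x hxO y hyO w hwO w' hwO' ⟨h1, h2⟩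
  have hex1 := arcLength_lt_one x a
  have hey1 := arcLength_lt_one y a
  have hey0 := arcLength_nonneg y a
  have hex0 := arcLength_pos hxa
  have hax : arcLength a x = 1 - arcLength x a := arcLength_comm hxa
  by_contra hcon
  by_cases hU : Upper a x
  · have hUy : ¬ Upper a y := fun h' => hcon (by simp [hU, h'])
    rw [Upper] at hU hUy
    rw [not_le] at hUy
    have e1 := arcLength_of_ge (b := a) (y := x) (z := y) (by linarith)
    have e2 : arcLength x b = arcLength a b - arcLength a x := arcLength_of_le (by linarith)
    have e3 := arcLength_le_of_fixed hn fy fa hUy.le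
    -- The bound in `e3` is attained only at b, and y is not b.
    have e4 : arcLength y a ≠ 1 / 2 - l / 2 := by
      intro h'
      refine hyb (arcLength_left_injective (b := a) ?_)
      rw [h', arcLength_comm hne, hB]; ring
    have e5 := lt_of_le_of_ne e3 e4
    refine key b a (Or.inr ⟨rfl, rfl⟩) ?_ ?_
    · rw [sbtw_iff_arcLength]
      constructor <;> linarith
    · rw [sbtw_cyclic, sbtw_iff_arcLength]
      constructor <;> linarith
  · have hUy : Upper a y := by
      by_contra h'; exact hcon (by simp [hU, h'])
    rw [Upper] at hU hUy
    rw [not_le] at hU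
    have e1 := arcLength_of_gt (b := a) (y := x) (z := y) (by linarith)
    have e2 : arcLength x b = arcLength a b - arcLength a x + 1 := arcLength_of_lt (by linarith)
    refine key a b (Or.inl ⟨rfl, rfl⟩) ?_ ?_
    · rw [sbtw_iff_arcLength]
      constructor <;> linarith
    · rw [sbtw_cyclic, sbtw_iff_arcLength]
      constructor <;> linarith

/-- The half circle is half-open, containing the antipode of a but not a, so it has exactly one
point of each antipodal pair. -/
theorem eq_of_double_eq {a x z : Angle} (h : double x = double z) (hU : Upper a x ↔ Upper a z) :
    x = z := by
  by_contra hne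
  have h1 := arcLength_of_double_eq h hne
  rw [Upper, Upper] at hU
  have hx := arcLength_lt_one x a
  have hz := arcLength_lt_one z a
  have hx' := arcLength_nonneg x a
  have hz' := arcLength_nonneg z a
  by_cases hle : arcLength z a ≤ arcLength x a
  · have := arcLength_of_ge hle
    have := hU.1 (by linarith)
    linarith
  · have := arcLength_of_gt (not_le.1 hle)
    have := hU.2 (by linarith)
    linarith

theorem eq_of_iterate_double_eq {a x z : Angle} {m : ℕ} (h : double^[m] x = double^[m] z)
    (hU : ∀ k < m, Upper a (double^[k] x) ↔ Upper a (double^[k] z)) : x = z := by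
  induction m with
  | zero => exact h
  | succ m ih =>
    rw [Function.iterate_succ_apply', Function.iterate_succ_apply'] at h
    exact ih (eq_of_double_eq h (hU m (by omega))) fun k hk => hU k (by omega)

/-- The open arc from `α` to `β`. -/
def InArc (α β x : Angle) : Prop := 0 < arcLength α x ∧ arcLength α x < arcLength α β

/-! ### Images of the narrow arc under doubling -/

namespace NarrowPair

variable {n : ℕ} {α β : Angle}

theorem double_last (h : NarrowPair n α β) : double (double^[n - 1] α) = α := by
  rw [← Function.iterate_succ_apply' double, Nat.succ_eq_add_one,
    Nat.sub_add_cancel (by have := h.two_le; omega), h.iterate_left]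

theorem length_pos (h : NarrowPair n α β) : 0 < arcLength α β := by
  have := four_le_two_pow h.two_le
  rw [h.length]
  exact div_pos one_pos (by linarith)

theorem length_le (h : NarrowPair n α β) : arcLength α β ≤ 1 / 3 := by
  have := four_le_two_pow h.two_le
  rw [h.length, div_le_div_iff₀ (by linarith) (by norm_num)]
  linarith

/-- This is where narrowness enters: 2^n l = 1 + l, so the image under h^(n-1) exceeds a half circle
by only l/2. -/
theorem two_pow_mul_length (h : NarrowPair n α β) :
    2 ^ (n - 1) * arcLength α β = 1 / 2 + arcLength α β / 2 := by
  have h4 := four_le_two_pow h.two_le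
  have h2n : (2 : ℝ) ^ n = 2 * 2 ^ (n - 1) := by
    rw [← pow_succ']; congr 1; have := h.two_le; omega
  have : (2 : ℝ) ^ n * arcLength α β = 1 + arcLength α β := by
    rw [h.length]
    have : (2 : ℝ) ^ n - 1 ≠ 0 := by linarith
    field_simp; ring
  rw [h2n] at this; linarith

theorem two_pow_mul_length_lt (h : NarrowPair n α β) {k : ℕ} (hk : k < n - 1) :
    2 ^ k * arcLength α β < 1 / 2 := by
  have h1 := h.two_pow_mul_length
  have h2 : (2 : ℝ) ^ (k + 1) ≤ 2 ^ (n - 1) := pow_le_pow_right₀ (by norm_num) (by omega)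
  have h3 := h.length_pos
  have h4 := h.length_le
  rw [pow_succ] at h2
  nlinarith

theorem ne (h : NarrowPair n α β) : α ≠ β := fun h' => by
  have := h.length_pos
  rw [h', arcLength_self] at this
  exact lt_irrefl _ this

theorem length_le_of_fixed (h : NarrowPair n α β) {y z : Angle} (hy : double^[n] y = y)
    (hz : double^[n] z = z) (hne : y ≠ z) : arcLength α β ≤ arcLength y z := by
  rw [h.length]
  exact arcLength_ge_of_fixed h.two_le hy hz hne

theorem arcLength_iterate (h : NarrowPair n α β) {k : ℕ} (hk : k < n - 1) :
    arcLength (double^[k] α) (double^[k] β) = 2 ^ k * arcLength α β :=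
  arcLength_iterate_double (by linarith [h.two_pow_mul_length_lt hk])

/-- The arc from h^k(α) to h^k(β) is shorter than 1/2 with both ends on one side of the diameter, so
it does not pass α̇. -/
theorem arcLength_iterate_eq_sub (h : NarrowPair n α β) {k : ℕ} (hk : k < n - 1) :
    2 ^ k * arcLength α β =
      arcLength (double^[k] α) (double^[n - 1] α) - arcLength (double^[k] β) (double^[n - 1] α) := by
  have h1 := h.arcLength_iterate hk
  have h2 := h.two_pow_mul_length_lt hk
  have hU := h.same_side k (by omega)
  have h3 := arcLength_lt_one (double^[k] β) (double^[n - 1] α)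
  have h4 := arcLength_nonneg (double^[k] α) (double^[n - 1] α)
  rw [Upper, Upper] at hU
  rw [← h1]
  by_cases hle : arcLength (double^[k] β) (double^[n - 1] α) ≤
      arcLength (double^[k] α) (double^[n - 1] α)
  · exact arcLength_of_ge hle
  · exfalso
    rw [not_le] at hle
    have h5 := arcLength_of_gt hle
    have h6 := hU.2 (by linarith)
    linarith

/-- The iterated arcs do not contain `α`. -/
theorem not_arcLength_lt (h : NarrowPair n α β) {i : ℕ} (hi0 : 0 < i) (hi : i < n) :
    2 ^ i * arcLength α β ≤ arcLength (double^[i] α) α := by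
  obtain ⟨k, rfl⟩ : ∃ k, i = k + 1 := ⟨i - 1, by omega⟩
  have hk : k < n - 1 := by omega
  have h1 := h.arcLength_iterate_eq_sub hk
  have hU := h.same_side k (by omega)
  have h2 := arcLength_nonneg (double^[k] β) (double^[n - 1] α)
  rw [Upper, Upper] at hU
  have h3 : arcLength (double^[k + 1] α) α =
      arcLength (double (double^[k] α)) (double (double^[n - 1] α)) := by
    rw [Function.iterate_succ_apply', h.double_last]
  rw [h3, pow_succ]
  by_cases hle : 1 / 2 ≤ arcLength (double^[k] α) (double^[n - 1] α)
  · rw [arcLength_double_of_ge hle]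
    have := hU.1 hle
    linarith
  · rw [not_le] at hle
    rw [arcLength_double_of_lt hle]
    linarith

theorem _root_.Narrow.InArc.arcLength_iterate (h : NarrowPair n α β) {x : Angle}
    (hx : InArc α β x) {k : ℕ} (hk : k < n) :
    arcLength (double^[k] α) (double^[k] x) = 2 ^ k * arcLength α x := by
  apply arcLength_iterate_double
  have h1 : (2 : ℝ) ^ k ≤ 2 ^ (n - 1) := pow_le_pow_right₀ (by norm_num) (by omega)
  have h2 := h.two_pow_mul_length
  have h3 := h.length_le
  have h4 : (0 : ℝ) < 2 ^ k := by positivity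
  have := hx.2
  have := hx.1
  nlinarith

theorem _root_.Narrow.InArc.between (h : NarrowPair n α β) {x : Angle}
    (hx : InArc α β x) {k : ℕ} (hk : k < n - 1) :
    arcLength (double^[k] β) (double^[n - 1] α) < arcLength (double^[k] x) (double^[n - 1] α) ∧
    arcLength (double^[k] x) (double^[n - 1] α) < arcLength (double^[k] α) (double^[n - 1] α) := by
  have h1 := h.arcLength_iterate_eq_sub hk
  have h2 := hx.arcLength_iterate h (k := k) (by omega)
  have hp : (0 : ℝ) < 2 ^ k := by positivity
  have h3 : 2 ^ k * arcLength α x < 2 ^ k * arcLength α β := mul_lt_mul_of_pos_left hx.2 hp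
  have h4 : 0 < 2 ^ k * arcLength α x := mul_pos hp hx.1
  by_cases hle : arcLength (double^[k] x) (double^[n - 1] α) ≤
      arcLength (double^[k] α) (double^[n - 1] α)
  · have := arcLength_of_ge hle
    constructor <;> linarith
  · have := arcLength_of_gt (not_le.1 hle)
    have := arcLength_lt_one (double^[k] x) (double^[n - 1] α)
    have := arcLength_nonneg (double^[k] β) (double^[n - 1] α)
    linarith

/-- Seen from α̇, the point h^k(x) lies between h^k(α) and h^k(β), which are in the same half
circle. Thus each point of the arc starts with v. -/
theorem _root_.Narrow.InArc.upper_iff (h : NarrowPair n α β) {x : Angle}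
    (hx : InArc α β x) {k : ℕ} (hk : k < n - 1) :
    Upper (double^[n - 1] α) (double^[k] x) ↔ Upper (double^[n - 1] α) (double^[k] α) := by
  obtain ⟨h1, h2⟩ := hx.between h hk
  have hU := h.same_side k (by omega)
  rw [Upper, Upper] at *
  constructor
  · intro h'; linarith
  · intro h'; linarith [hU.1 h']

/-- The image of the arc under `double^[n - 1]` consists of one half circle and of a short arc,
which doubling maps to the arc. -/
theorem inArc_double_iff (h : NarrowPair n α β) (y : Angle) :
    (Upper (double^[n - 1] α) y ∨ InArc α β (double y)) ↔
      0 < arcLength (double^[n - 1] α) y ∧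
        arcLength (double^[n - 1] α) y < 1 / 2 + arcLength α β / 2 := by
  have hl := h.length_pos
  have h1 := arcLength_lt_one (double^[n - 1] α) y
  rcases eq_or_ne (double^[n - 1] α) y with rfl | hne
  · simp [Upper, InArc, h.double_last]
  have hpos := arcLength_pos hne
  have hc := arcLength_comm hne
  rw [Upper, InArc, hc]
  by_cases hle : 1 / 2 ≤ arcLength (double^[n - 1] α) y
  · have := arcLength_double_of_ge hle
    rw [h.double_last] at this
    rw [this]
    constructor
    · rintro (h' | h')
      · exact ⟨hpos, by linarith⟩
      · exact ⟨hpos, by linarith [h'.2]⟩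
    · rintro ⟨-, h'⟩
      rcases hle.eq_or_lt with heq | hlt
      · left; linarith
      · right; constructor <;> linarith
  · rw [not_le] at hle
    constructor
    · intro; constructor <;> linarith
    · intro; left; linarith

/-- This is the recursion behind the algorithm: a block, followed by the symbol e or by a return to
the arc after n steps. -/
theorem inArc_iff (h : NarrowPair n α β) (x : Angle) :
    InArc α β x ↔
      (∀ k < n - 1, Upper (double^[n - 1] α) (double^[k] x) ↔
        Upper (double^[n - 1] α) (double^[k] α)) ∧
      (Upper (double^[n - 1] α) (double^[n - 1] x) ∨ InArc α β (double^[n] x)) := by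
  have hn := h.two_le
  have hp : (0 : ℝ) < 2 ^ (n - 1) := by positivity
  have hl := h.two_pow_mul_length
  have hs : double^[n] x = double (double^[n - 1] x) := by
    rw [← Function.iterate_succ_apply' double, Nat.succ_eq_add_one, Nat.sub_add_cancel (by omega)]
  rw [hs, h.inArc_double_iff]
  constructor
  · intro hx
    refine ⟨fun k hk => hx.upper_iff h hk, ?_⟩
    rw [hx.arcLength_iterate h (by omega), ← hl]
    exact ⟨mul_pos hp hx.1, mul_lt_mul_of_pos_left hx.2 hp⟩
  · rintro ⟨hU, h1, h2⟩
    rw [← hl] at h2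
    set r := arcLength (double^[n - 1] α) (double^[n - 1] x) with hr
    -- The preimage of h^(n-1)(x) under h^(n-1) that lies in the arc; it visits the same half
    -- circles as x, so it equals x.
    have hz : InArc α β (α + ((r / 2 ^ (n - 1) : ℝ) : Angle)) := by
      have h3 : r / 2 ^ (n - 1) < arcLength α β := by
        rw [div_lt_iff₀ hp, mul_comm]; exact h2
      have h4 : 0 < r / 2 ^ (n - 1) := div_pos h1 hp
      rw [InArc, arcLength_eq h4.le (by linarith [h.length_le]) (by simp)]
      exact ⟨h4, h3⟩
    have hzx : double^[n - 1] x = double^[n - 1] (α + ((r / 2 ^ (n - 1) : ℝ) : Angle)) := by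
      rw [iterate_double_add, iterate_double_coe, mul_div_cancel₀ _ hp.ne', hr, add_arcLength]
    rw [eq_of_iterate_double_eq (a := double^[n - 1] α) hzx]
    · exact hz
    · intro k hk
      rw [hU k hk, hz.upper_iff h hk]

/-- The arc from h^i(α) to h^i(x) would have to pass α, since no fixed point of h^n lies inside the
arc (α, β). But the i-th image of the arc does not reach beyond α. So swapped blocks never overlap.
-/
theorem not_inArc_iterate (h : NarrowPair n α β) {x : Angle} (hx : InArc α β x) {i : ℕ}
    (hi0 : 0 < i) (hi : i < n) : ¬ InArc α β (double^[i] x) := by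
  intro hxi
  have h1 := h.not_arcLength_lt hi0 hi
  have h2 := hx.arcLength_iterate h hi
  have hne := h.ne_left i hi0 hi
  have h3 := h.length_le_of_fixed h.iterate_left (iterate_fixed h.iterate_left i) hne.symm
  have h4 := hxi.2
  have h5 := arcLength_of_lt (h4.trans_le h3)
  have h6 := arcLength_comm hne.symm
  have hp : (0 : ℝ) < 2 ^ i := by positivity
  have h7 : 2 ^ i * arcLength α x < 2 ^ i * arcLength α β := mul_lt_mul_of_pos_left hx.2 hp
  have h8 := hxi.1
  linarith

end NarrowPair

/-! ### Symbols -/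

theorem half_eq (x : Angle) : half x = ((arcLength 0 x / 2 : ℝ) : Angle) := by
  rw [half, arcLength, sub_zero]

theorem half'_eq (x : Angle) : half' x = half x + ((1 / 2 : ℝ) : Angle) := by
  rw [half_eq, half', ← AddCircle.coe_add, arcLength, sub_zero, add_div]

theorem double_half (x : Angle) : double (half x) = x := by
  rw [half_eq, double_coe, mul_div_cancel₀ _ two_ne_zero]
  simpa using add_arcLength 0 x

theorem arcLength_add_half (x : Angle) : arcLength x (x + ((1 / 2 : ℝ) : Angle)) = 1 / 2 :=
  arcLength_eq (by norm_num) (by norm_num) (by abel)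

theorem double_add_half (x : Angle) : double (x + ((1 / 2 : ℝ) : Angle)) = double x := by
  rw [double_add, double_coe, mul_one_div_cancel two_ne_zero, coe_one_angle, add_zero]

theorem eq_half_or_eq_half' (y : Angle) : y = half (double y) ∨ y = half' (double y) := by
  by_cases hy : half (double y) = y
  · exact Or.inl hy.symm
  · right
    have := arcLength_of_double_eq (double_half (double y)) hy
    rw [half'_eq]
    refine arcLength_right_injective (b := half (double y)) ?_
    rw [arcLength_add_half, this]

theorem symbol_eq (α y : Angle) :
    symbol α y = if 0 < arcLength (half α) y ∧ arcLength (half α) y < 1 / 2 then some 0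
      else if 1 / 2 < arcLength (half α) y then some 1 else none := by
  have h1 : sbtw (half α) y (half' α) ↔
      0 < arcLength (half α) y ∧ arcLength (half α) y < 1 / 2 := by
    rw [sbtw_iff_arcLength, half'_eq, arcLength_add_half]
  have h2 : sbtw (half' α) y (half α) ↔ 1 / 2 < arcLength (half α) y := by
    rw [sbtw_cyclic, sbtw_iff_arcLength, half'_eq, arcLength_add_half]
    norm_num
  rw [symbol]
  simp only [h1, h2]

open Classical in
/-- The symbol of the points in the half circle `Upper a`, where `a` is one of the two preimages
of `α`. -/
noncomputable def upperSymbol (α a : Angle) : Fin 2 := if a = half α then 0 else 1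

open Classical in
theorem symbol_eq_of_double_ne {α a y : Angle} (ha : double a = α) (hy : double y ≠ α) :
    symbol α y = some (if Upper a y then upperSymbol α a else 1 - upperSymbol α a) := by
  have hya : a ≠ y := by rintro rfl; exact hy ha
  have h1 := arcLength_lt_one (half α) y
  have h0 : 0 < arcLength (half α) y :=
    arcLength_pos (by rintro rfl; exact hy (double_half α))
  have h2 : arcLength (half α) y ≠ 1 / 2 := by
    intro h'
    have := arcLength_double_of_ge h'.ge
    rw [h', double_half, mul_one_div_cancel two_ne_zero, sub_self, arcLength_eq_zero] at this
    exact hy this.symm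
  rw [symbol_eq, upperSymbol, Upper]
  by_cases hah : a = half α
  · rw [if_pos hah, hah, arcLength_comm (x := half α) (by rwa [← hah])]
    rcases lt_or_gt_of_ne h2 with h | h
    · rw [if_pos ⟨h0, h⟩, if_pos (by linarith)]
    · rw [if_neg (by rintro ⟨-, h'⟩; linarith), if_pos h, if_neg (by linarith)]
      rfl
  · have ha' : a = half' α := by
      have := eq_half_or_eq_half' a
      rw [ha] at this
      exact this.resolve_left hah
    have h3 : arcLength (half α) a = 1 / 2 := by rw [ha', half'_eq, arcLength_add_half]
    rw [if_neg hah]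
    rcases lt_or_gt_of_ne h2 with h | h
    · have := arcLength_of_le (b := half α) (y := y) (z := a) (by linarith)
      rw [if_pos ⟨h0, h⟩, if_neg (by linarith)]
      rfl
    · have := arcLength_of_lt (b := half α) (y := y) (z := a) (by linarith)
      rw [if_neg (by rintro ⟨-, h'⟩; linarith), if_pos h, if_pos (by linarith)]

theorem one_sub_ne (c : Fin 2) : 1 - c ≠ c := by revert c; decide

theorem eq_one_sub_of_ne {c d : Fin 2} (h : c ≠ d) : c = 1 - d := by
  revert c d; decide

/-- Two points have the same symbol if and only if they are in the same half circle. -/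
theorem symbol_eq_symbol_iff {α a y z : Angle} (ha : double a = α) (hy : double y ≠ α)
    (hz : double z ≠ α) : symbol α y = symbol α z ↔ (Upper a y ↔ Upper a z) := by
  classical
  rw [symbol_eq_of_double_ne ha hy, symbol_eq_of_double_ne ha hz, Option.some_inj]
  by_cases h1 : Upper a y <;> by_cases h2 : Upper a z <;>
    simp [h1, h2, one_sub_ne, (one_sub_ne _).symm]

theorem symbol_eq_upperSymbol_iff {α a y : Angle} (ha : double a = α) (hy : double y ≠ α) :
    symbol α y = some (upperSymbol α a) ↔ Upper a y := by
  classical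
  rw [symbol_eq_of_double_ne ha hy, Option.some_inj]
  by_cases h1 : Upper a y <;> simp [h1, one_sub_ne]

namespace NarrowPair

variable {n : ℕ} {α β : Angle}

theorem iterate_zero_angle (k : ℕ) : double^[k] (0 : Angle) = 0 := by
  simpa using iterate_double_coe k 0

/-- The fixed angle 0 is not in the arc, as it would be closer to α than l. This is needed because
`half` depends on representatives in [0, 1). -/
theorem arcLength_zero_right (h : NarrowPair n α β) :
    arcLength 0 β = arcLength 0 α + arcLength α β := by
  have hn := h.two_le
  have hα : (0 : Angle) ≠ α := by
    rintro rfl; exact h.ne_left 1 one_pos (by omega) (iterate_zero_angle 1)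
  have hβ : (0 : Angle) ≠ β := by
    rintro rfl; exact h.ne_right 1 one_pos (by omega) (iterate_zero_angle 1)
  by_cases hle : arcLength 0 α ≤ arcLength 0 β
  · rw [arcLength_of_le hle]; ring
  · have h1 := arcLength_of_lt (not_le.1 hle)
    have h2 := h.length_le_of_fixed h.iterate_left (iterate_zero_angle n) hα.symm
    have h3 := arcLength_comm hα
    have h4 := arcLength_pos hβ
    linarith

theorem half_right (h : NarrowPair n α β) :
    arcLength (half α) (half β) = arcLength α β / 2 := by
  have h1 := h.length_pos
  have h2 := h.length_le
  refine arcLength_eq (by linarith) (by linarith) ?_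
  rw [half_eq, half_eq, h.arcLength_zero_right, ← AddCircle.coe_sub]
  congr 1; ring

open Classical in
/-- The symbols of a point with respect to `α` and `β` differ if and only if its image is in the
arc from `α` to `β`. -/
theorem symbol_right (h : NarrowPair n α β) {y : Angle} (hα : double y ≠ α) (hβ : double y ≠ β)
    {c : Fin 2} (hc : symbol α y = some c) :
    symbol β y = some (if InArc α β (double y) then 1 - c else c) := by
  -- From α to β the diameter turns by l/2. Symbols change just in the two sectors it sweeps, and
  -- these are the preimages of the arc.
  have hg := h.half_right
  have hl := h.length_pos
  have hl3 := h.length_le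
  have h1 := arcLength_lt_one (half α) y
  have h0 : 0 < arcLength (half α) y :=
    arcLength_pos (by rintro rfl; exact hα (double_half α))
  have hd : ∀ r, arcLength α (double y) = r → r ≠ 0 ∧ r ≠ arcLength α β := by
    rintro r rfl
    exact ⟨fun h' => hα (arcLength_eq_zero.1 h').symm, fun h' => hβ (arcLength_right_injective h')⟩
  have e1 := arcLength_double_of_lt (x := half α) (y := y)
  have e2 := arcLength_double_of_ge (x := half α) (y := y)
  rw [double_half] at e1 e2
  have e3 := arcLength_of_le (b := half α) (y := half β) (z := y)
  have e4 := arcLength_of_lt (b := half α) (y := half β) (z := y)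
  rw [symbol_eq] at hc ⊢
  rw [InArc]
  generalize arcLength (half α) y = t at *
  generalize arcLength (half β) y = t' at *
  rw [hg] at e3 e4
  rcases lt_trichotomy t (1 / 2) with ht | ht | ht
  · rw [if_pos ⟨h0, ht⟩, Option.some_inj] at hc
    subst hc
    have e1' := e1 ht
    have hd' := hd _ e1'
    rw [e1']
    by_cases ht' : arcLength α β / 2 ≤ t
    · have e3' := e3 ht'
      have : arcLength α β / 2 ≠ t := fun h' => hd'.2 (by linarith)
      have := lt_of_le_of_ne ht' this
      rw [if_pos (by constructor <;> linarith), if_neg (by rintro ⟨_, _⟩; linarith)]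
    · have e4' := e4 (not_le.1 ht')
      rw [not_le] at ht'
      rw [if_neg (by rintro ⟨_, _⟩; linarith), if_pos (by linarith),
        if_pos (by constructor <;> linarith)]
      rfl
  · rw [ht] at e2
    exact absurd (by norm_num) (hd _ (e2 le_rfl)).1
  · rw [if_neg (by rintro ⟨_, _⟩; linarith), if_pos ht, Option.some_inj] at hc
    subst hc
    have e2' := e2 ht.le
    have hd' := hd _ e2'
    have e3' := e3 (by linarith)
    rw [e2']
    by_cases ht' : t' < 1 / 2
    · rw [if_pos (by constructor <;> linarith), if_pos (by constructor <;> linarith)]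
      rfl
    · have : t' ≠ 1 / 2 := fun h' => hd'.2 (by linarith)
      have := lt_of_le_of_ne (not_lt.1 ht') this.symm
      rw [if_neg (by rintro ⟨_, _⟩; linarith), if_pos (by linarith),
        if_neg (by rintro ⟨_, _⟩; linarith)]

end NarrowPair

/-! ### Inverse branches and the characteristic symbol -/

theorem branch_double {α y : Angle} {t s : Fin 2} (hy : double y ≠ α) (hs : symbol α y = some s) :
    branch α t s (double y) = y := by
  have ha := double_half α
  have hn : double (half (double y)) ≠ α := by rwa [double_half]
  rw [branch, if_neg hy]
  by_cases hh : symbol α (half (double y)) = some s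
  · rw [if_pos hh]
    refine eq_of_double_eq (a := half α) (double_half _) ?_
    rw [← symbol_eq_symbol_iff ha hn hy, hh, hs]
  · rw [if_neg hh]
    rcases eq_half_or_eq_half' y with h | h
    · rw [← h] at hh; exact absurd hs hh
    · exact h.symm

theorem branchWord_iterate {α y : Angle} {t : Fin 2} (w : List (Fin 2))
    (hy : ∀ k < w.length, double^[k + 1] y ≠ α)
    (hs : ∀ (k : ℕ) (hk : k < w.length), symbol α (double^[k] y) = some w[k]) :
    branchWord α t w (double^[w.length] y) = y := by
  induction w generalizing y with
  | nil => rfl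
  | cons s w ih =>
    rw [branchWord, List.foldr_cons, ← branchWord, List.length_cons, Function.iterate_succ_apply,
      ih, branch_double (by simpa using hy 0) (by simpa using hs 0)]
    · intro k hk
      rw [← Function.iterate_succ_apply]
      exact hy (k + 1) (by simpa using hk)
    · intro k hk
      rw [← Function.iterate_succ_apply]
      exact hs (k + 1) (by simpa using hk)

namespace NarrowPair

variable {n : ℕ} {α β : Angle}

theorem length_repetitionWord (α : Angle) : (repetitionWord α).length = period α - 1 := by
  rw [repetitionWord, List.length_ofFn]

theorem symbol_eq_getElem {α : Angle} (h : NarrowPair (period α) α β) {k : ℕ}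
    (hk : k < (repetitionWord α).length) :
    symbol α (double^[k] α) = some (repetitionWord α)[k] := by
  classical
  have hk' := hk
  rw [length_repetitionWord] at hk'
  have hs := symbol_eq_of_double_ne h.double_last (y := double^[k] α) (by
    rw [← Function.iterate_succ_apply' double]; exact h.ne_left _ (by omega) (by omega))
  simp only [repetitionWord, List.getElem_ofFn, itinerary]
  rw [hs]; rfl

theorem length_repetitionWord_add_one {α : Angle} (h : NarrowPair (period α) α β) :
    (repetitionWord α).length + 1 = period α := by
  rw [length_repetitionWord]; have := h.two_le; omega

theorem branchWord_dot {α : Angle} (h : NarrowPair (period α) α β) (t : Fin 2) :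
    branchWord α t (repetitionWord α) (dot α) = α := by
  have := branchWord_iterate (t := t) (repetitionWord α) (y := α) (fun k hk => by
    rw [length_repetitionWord] at hk
    exact h.ne_left _ (by omega) (by omega)) fun k hk => h.symbol_eq_getElem hk
  rwa [length_repetitionWord] at this

/-- The point on the right lies in the arc, so it starts with v, and h^(n-1) maps it to α̈. -/
theorem branchWord_ddot {α : Angle} (h : NarrowPair (period α) α β) (t : Fin 2) :
    branchWord α t (repetitionWord α) (ddot α) =
      α + ((1 / 2 / 2 ^ (period α - 1) : ℝ) : Angle) := by
  have hn := h.two_le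
  have hp : (0 : ℝ) < 2 ^ (period α - 1) := by positivity
  have hl := h.two_pow_mul_length
  have hl0 := h.length_pos
  set z := α + ((1 / 2 / 2 ^ (period α - 1) : ℝ) : Angle) with hz
  have hzin : InArc α β z := by
    have h3 : 1 / 2 / 2 ^ (period α - 1) < arcLength α β := by
      rw [div_lt_iff₀ hp, mul_comm, hl]; linarith
    have h4 : (0 : ℝ) < 1 / 2 / 2 ^ (period α - 1) := by positivity
    rw [InArc, arcLength_eq h4.le (by linarith [h.length_le]) (by rw [hz]; simp)]
    exact ⟨h4, h3⟩
  have hit : double^[period α - 1] z = ddot α := by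
    rw [hz, iterate_double_add, iterate_double_coe, mul_div_cancel₀ _ hp.ne', ddot, dot]
  -- Meeting α would put α̈ on the orbit of α, hence make it fixed by h^n; but h^n maps it to α̇.
  have hne : ∀ k < period α - 1, double^[k + 1] z ≠ α := by
    intro k hk h'
    have hdd : ddot α = double^[period α - 1 - (k + 1)] α :=
      calc ddot α = double^[period α - 1] z := hit.symm
        _ = double^[period α - 1 - (k + 1) + (k + 1)] z := by rw [Nat.sub_add_cancel (by omega)]
        _ = _ := by rw [Function.iterate_add_apply, h']
    have hfix : double^[period α] (ddot α) = ddot α := by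
      rw [hdd]; exact iterate_fixed h.iterate_left _
    have hd : double (ddot α) = double (dot α) := double_add_half _
    have e1 : ∀ x, double^[period α] x = double^[period α - 1] (double x) := fun x => by
      rw [← Function.iterate_succ_apply]; congr 2; omega
    have hdot : double^[period α] (dot α) = dot α := iterate_fixed h.iterate_left _
    rw [e1, hd, ← e1, hdot] at hfix
    have := arcLength_add_half (dot α)
    rw [← ddot, ← hfix, arcLength_self] at this
    norm_num at this
  have := branchWord_iterate (t := t) (repetitionWord α) (y := z) (fun k hk => by
    rw [length_repetitionWord] at hk
    exact hne k hk) fun k hk => by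
      rw [← h.symbol_eq_getElem hk]
      rw [length_repetitionWord] at hk
      refine (symbol_eq_symbol_iff h.double_last ?_ ?_).2 (hzin.upper_iff h hk)
      · rw [← Function.iterate_succ_apply' double]; exact hne k hk
      · rw [← Function.iterate_succ_apply' double]; exact h.ne_left _ (by omega) (by omega)
  rwa [length_repetitionWord, hit] at this

theorem dist_coe_add (x : Angle) {r : ℝ} (h0 : 0 ≤ r) (h1 : r ≤ 1 / 2) :
    dist x (x + (r : Angle)) = r := by
  have h : -(x - (x + (r : Angle))) = (r : Angle) := by abel
  rw [dist_eq_norm, ← norm_neg, h,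
    (AddCircle.norm_coe_eq_abs_iff 1 one_ne_zero).2 (by rwa [abs_one, abs_of_nonneg h0]),
    abs_of_nonneg h0]

/-- The branch along v takes α̇ and α̈ to α and α + 2r with r at most 1/8. For t = 0 the last branch
sends α to α̇, and α + 2r to α̇ + r or to its antipode, according to the symbol of the half circle
after α̇. The chord has length r or 1/2 - r. -/
theorem charSymbol_eq {α : Angle} (h : NarrowPair (period α) α β) :
    charSymbol α = upperSymbol α (dot α) := by
  classical
  have hn := h.two_le
  have h1 : branchWord α 0 (0 :: repetitionWord α) (dot α) = dot α := by
    rw [branchWord, List.foldr_cons, ← branchWord, h.branchWord_dot, branch, if_pos rfl, if_pos rfl]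
  obtain ⟨r, hr, hr0, hr1⟩ : ∃ r : ℝ, 1 / 2 / 2 ^ (period α - 1) = 2 * r ∧ 0 < r ∧ r ≤ 1 / 8 := by
    refine ⟨1 / 2 / 2 ^ (period α - 1) / 2, by ring, by positivity, ?_⟩
    have : (2 : ℝ) ^ 1 ≤ 2 ^ (period α - 1) := pow_le_pow_right₀ (by norm_num) (by omega)
    rw [div_div, div_div, div_le_div_iff₀ (by positivity) (by norm_num)]
    linarith
  have h2 : branchWord α 0 (0 :: repetitionWord α) (ddot α) =
      branch α 0 0 (α + ((2 * r : ℝ) : Angle)) := by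
    rw [branchWord, List.foldr_cons, ← branchWord, h.branchWord_ddot, hr]
  have hz : α + ((2 * r : ℝ) : Angle) ≠ α := by
    intro h'
    have := arcLength_eq (x := α) (y := α + ((2 * r : ℝ) : Angle)) (r := 2 * r) (by linarith)
      (by linarith) (by abel)
    rw [h', arcLength_self] at this
    linarith
  have hd : double (dot α) = α := h.double_last
  have hy1 : double (dot α + (r : Angle)) = α + ((2 * r : ℝ) : Angle) := by
    rw [double_add, hd, double_coe]
  have hy2 : double (dot α + ((1 / 2 + r : ℝ) : Angle)) = α + ((2 * r : ℝ) : Angle) := by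
    rw [AddCircle.coe_add, add_comm ((1 / 2 : ℝ) : Angle), ← add_assoc, double_add_half, hy1]
  rw [charSymbol, chordLength, h1, h2]
  by_cases hu : upperSymbol α (dot α) = 0
  · have hU : Upper (dot α) (dot α + (r : Angle)) := by
      have h3 := arcLength_eq (x := dot α) (y := dot α + (r : Angle)) hr0.le (by linarith) (by abel)
      have hne : dot α ≠ dot α + (r : Angle) := by
        intro h'; rw [← h', arcLength_self] at h3; linarith
      rw [Upper, arcLength_comm hne, h3]; linarith
    have hs := (symbol_eq_upperSymbol_iff hd (hy1.symm ▸ hz)).2 hU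
    rw [hu] at hs
    rw [← hy1, branch_double (hy1.symm ▸ hz) hs, dist_coe_add _ hr0.le (by linarith),
      if_pos (by linarith), hu]
  · have hu1 : upperSymbol α (dot α) = 1 := eq_one_sub_of_ne hu
    have hU : ¬ Upper (dot α) (dot α + ((1 / 2 + r : ℝ) : Angle)) := by
      have h3 := arcLength_eq (x := dot α) (y := dot α + ((1 / 2 + r : ℝ) : Angle)) (r := 1 / 2 + r)
        (by linarith) (by linarith) (by abel)
      have hne : dot α ≠ dot α + ((1 / 2 + r : ℝ) : Angle) := by
        intro h'; rw [← h', arcLength_self] at h3; linarith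
      rw [Upper, arcLength_comm hne, h3]; linarith
    have hs := symbol_eq_of_double_ne hd (hy2.symm ▸ hz)
    rw [if_neg hU, hu1, sub_self] at hs
    have hdist : dist (dot α) (dot α + ((1 / 2 + r : ℝ) : Angle)) = 1 / 2 - r := by
      have h3 : dot α = dot α + ((1 / 2 + r : ℝ) : Angle) + ((1 / 2 - r : ℝ) : Angle) := by
        rw [add_assoc, ← AddCircle.coe_add, show (1 / 2 + r + (1 / 2 - r) : ℝ) = 1 by ring,
          coe_one_angle, add_zero]
      rw [dist_comm]
      conv_lhs => rw [h3]
      conv_lhs => arg 1; rw [← h3]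
      rw [dist_coe_add _ (by linarith) (by linarith)]
    rw [← hy2, branch_double (hy2.symm ▸ hz) hs, hdist, if_neg (by linarith), hu1]

end NarrowPair

/-! ### Points whose iterates are in the same half circles -/

/-- All iterates of the two points are in the same half circles. -/
def SameSide (a y z : Angle) : Prop :=
  ∀ k, Upper a (double^[k] y) ↔ Upper a (double^[k] z)

theorem SameSide.symm {a y z : Angle} (h : SameSide a y z) : SameSide a z y := fun k => (h k).symm

theorem SameSide.trans {a y z w : Angle} (h : SameSide a y z) (h' : SameSide a z w) :
    SameSide a y w := fun k => (h k).trans (h' k)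

theorem SameSide.iterate {a y z : Angle} (h : SameSide a y z) (i : ℕ) :
    SameSide a (double^[i] y) (double^[i] z) := fun k => by
  rw [← Function.iterate_add_apply, ← Function.iterate_add_apply]; exact h (k + i)

/-- The arc from y to z either stays in the common half circle and is shorter than 1/2, or contains
the complementary half circle, and then doubling drops one full turn. -/
theorem Upper.arcLength_cases {a y z : Angle} (h : Upper a y ↔ Upper a z) :
    (arcLength z a ≤ arcLength y a ∧ arcLength y z = arcLength y a - arcLength z a ∧
      arcLength (double y) (double z) = 2 * (arcLength y a - arcLength z a)) ∨
    (arcLength y a < arcLength z a ∧ arcLength y z = arcLength y a - arcLength z a + 1 ∧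
      arcLength (double y) (double z) = 2 * (arcLength y a - arcLength z a) + 1) := by
  have hy0 := arcLength_nonneg y a
  have hz0 := arcLength_nonneg z a
  have hy1 := arcLength_lt_one y a
  have hz1 := arcLength_lt_one z a
  rw [Upper, Upper] at h
  rcases le_or_gt (arcLength z a) (arcLength y a) with hle | hlt
  · left
    have h1 := arcLength_of_ge hle
    refine ⟨hle, h1, ?_⟩
    rw [arcLength_double_of_lt, h1]
    by_contra! h2
    linarith [h.1 (by linarith)]
  · right
    have h1 := arcLength_of_gt hlt
    refine ⟨hlt, h1, ?_⟩
    rw [arcLength_double_of_ge, h1]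
    · ring
    · by_contra! h2
      linarith [h.2 (by linarith)]

/-- Doubling is injective on a half circle and preserves cyclic order there. -/
theorem arcLength_double_lt {a y z w : Angle} (hz : Upper a y ↔ Upper a z)
    (hw : Upper a y ↔ Upper a w) (h0 : 0 < arcLength y z) (h1 : arcLength y z < arcLength y w) :
    0 < arcLength (double y) (double z) ∧
      arcLength (double y) (double z) < arcLength (double y) (double w) := by
  have cz := Upper.arcLength_cases hz
  have cw := Upper.arcLength_cases hw
  have hy0 := arcLength_nonneg y a
  have hz0 := arcLength_nonneg z a
  have hw0 := arcLength_nonneg w a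
  have hy1 := arcLength_lt_one y a
  have hz1 := arcLength_lt_one z a
  have hw1 := arcLength_lt_one w a
  by_cases hU : Upper a y
  · have hUz := hz.1 hU
    have hUw := hw.1 hU
    rw [Upper] at hU hUz hUw
    rcases cz with ⟨z1, z2, z3⟩ | ⟨z1, z2, z3⟩ <;> rcases cw with ⟨w1, w2, w3⟩ | ⟨w1, w2, w3⟩ <;>
      constructor <;> linarith
  · have hUz : ¬ Upper a z := fun h => hU (hz.2 h)
    have hUw : ¬ Upper a w := fun h => hU (hw.2 h)
    rw [Upper, not_le] at hU hUz hUw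
    rcases cz with ⟨z1, z2, z3⟩ | ⟨z1, z2, z3⟩ <;> rcases cw with ⟨w1, w2, w3⟩ | ⟨w1, w2, w3⟩ <;>
      constructor <;> linarith

theorem SameSide.arcLength_iterate_lt {a y z w : Angle} (hz : SameSide a y z)
    (hw : SameSide a y w) (h0 : 0 < arcLength y z) (h1 : arcLength y z < arcLength y w) (k : ℕ) :
    0 < arcLength (double^[k] y) (double^[k] z) ∧
      arcLength (double^[k] y) (double^[k] z) < arcLength (double^[k] y) (double^[k] w) := by
  induction k with
  | zero => exact ⟨h0, h1⟩
  | succ k ih =>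
    simp only [Function.iterate_succ_apply']
    exact arcLength_double_lt (hz k) (hw k) ih.1 ih.2

/-- Chords with ends in opposite half circles are separated by the diameter and cannot cross. -/
theorem Upper.iff_of_crossing {a p q y z : Angle} (hpq : Upper a p ↔ Upper a q)
    (hyz : Upper a y ↔ Upper a z) (h1 : arcLength y p < arcLength y z)
    (h2 : arcLength y z < arcLength y q) : Upper a y ↔ Upper a p := by
  have cz := Upper.arcLength_cases hyz
  have hy0 := arcLength_nonneg y a
  have hz0 := arcLength_nonneg z a
  have hp0 := arcLength_nonneg p a
  have hq0 := arcLength_nonneg q a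
  have hy1 := arcLength_lt_one y a
  have hz1 := arcLength_lt_one z a
  have hp1 := arcLength_lt_one p a
  have hq1 := arcLength_lt_one q a
  have dp := arcLength_of_ge (b := a) (y := y) (z := p)
  have dp' := arcLength_of_gt (b := a) (y := y) (z := p)
  have dq := arcLength_of_ge (b := a) (y := y) (z := q)
  have dq' := arcLength_of_gt (b := a) (y := y) (z := q)
  by_contra hcon
  by_cases hU : Upper a y
  · have hUz := hyz.1 hU
    have hUp : ¬ Upper a p := fun h => hcon (by simp [h, hU])
    have hUq : ¬ Upper a q := fun h => hUp (hpq.2 h)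
    rw [Upper] at hU hUz hUp hUq
    rw [not_le] at hUp hUq
    have dp := dp (by linarith)
    have dq := dq (by linarith)
    rcases cz with ⟨z1, z2, -⟩ | ⟨z1, z2, -⟩ <;> linarith
  · have hUz : ¬ Upper a z := fun h => hU (hyz.2 h)
    have hUp : Upper a p := by by_contra h; exact hcon (by simp [h, hU])
    have hUq := hpq.1 hUp
    rw [Upper] at hU hUz hUp hUq
    rw [not_le] at hU hUz
    have dp := dp' (by linarith)
    have dq := dq' (by linarith)
    rcases cz with ⟨z1, z2, -⟩ | ⟨z1, z2, -⟩ <;> linarith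

/-- The classes of `SameSide` are unlinked. -/
theorem SameSide.of_crossing {a p q y z : Angle} (hpq : SameSide a p q) (hyz : SameSide a y z)
    (h0 : 0 < arcLength y p) (h1 : arcLength y p < arcLength y z)
    (h2 : arcLength y z < arcLength y q) : SameSide a y p := by
  intro k
  -- Crossing persists: it forces all four points into one half circle, where doubling keeps their
  -- order.
  suffices h : 0 < arcLength (double^[k] y) (double^[k] p) ∧
      arcLength (double^[k] y) (double^[k] p) < arcLength (double^[k] y) (double^[k] z) ∧
      arcLength (double^[k] y) (double^[k] z) < arcLength (double^[k] y) (double^[k] q) from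
    Upper.iff_of_crossing (hpq k) (hyz k) h.2.1 h.2.2
  induction k with
  | zero => exact ⟨h0, h1, h2⟩
  | succ k ih =>
    obtain ⟨i0, i1, i2⟩ := ih
    have hU := Upper.iff_of_crossing (hpq k) (hyz k) i1 i2
    simp only [Function.iterate_succ_apply']
    have h3 := arcLength_double_lt hU (hyz k) i0 i1
    have h4 := arcLength_double_lt (hyz k) (hU.trans (hpq k)) (i0.trans i1) i2
    exact ⟨h3.1, h3.2, h4.2⟩

/-! ### Gaps of the classes of periodic points -/

/-- The arc from `y` to `z` is bounded by adjacent points of a class of `SameSide`, among the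
points fixed by `double^[n]`. -/
structure Gap (n : ℕ) (a y z : Angle) : Prop where
  left : double^[n] y = y
  right : double^[n] z = z
  ne : y ≠ z
  sameSide : SameSide a y z
  empty : ∀ w, double^[n] w = w → SameSide a y w → 0 < arcLength y w →
    arcLength y z ≤ arcLength y w

theorem iterate_mul_fixed {n : ℕ} {x : Angle} (hx : double^[n] x = x) (k : ℕ) :
    double^[n * k] x = x := by
  rw [Function.iterate_mul]; exact Function.iterate_fixed hx k

theorem iterate_sub_iterate {n : ℕ} (hn : 0 < n) {x : Angle} (hx : double^[n] x = x) (k : ℕ) :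
    double^[n * k - k] (double^[k] x) = x := by
  rw [← Function.iterate_add_apply, Nat.sub_add_cancel (Nat.le_mul_of_pos_left k hn),
    iterate_mul_fixed hx]

/-- On fixed points of h^n, h^k is inverted by h^(nk-k), which preserves order on classes; a class
point inside the image gap would be carried back into the original one. -/
theorem Gap.iterate {n : ℕ} (hn : 0 < n) {a y z : Angle} (h : Gap n a y z) (k : ℕ) :
    Gap n a (double^[k] y) (double^[k] z) := by
  have hy := iterate_sub_iterate hn h.left k
  have hz := iterate_sub_iterate hn h.right k
  refine ⟨iterate_fixed h.left k, iterate_fixed h.right k, ?_, h.sameSide.iterate k, ?_⟩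
  · intro h'
    rw [h', hz] at hy
    exact h.ne hy.symm
  · intro w hw hs h0
    by_contra! hlt
    have h1 := hs.arcLength_iterate_lt (h.sameSide.iterate k) h0 hlt (n * k - k)
    have h2 := hs.iterate (n * k - k)
    rw [hy, hz] at h1
    rw [hy] at h2
    exact absurd (h.empty _ (iterate_fixed hw _) h2 h1.1) (not_le.2 h1.2)

theorem Gap.unique {n : ℕ} {a y z z' : Angle} (h : Gap n a y z) (h' : Gap n a y z') : z = z' :=
  arcLength_right_injective (b := y) (le_antisymm
    (h.empty _ h'.right h'.sameSide (arcLength_pos h'.ne))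
    (h'.empty _ h.right h.sameSide (arcLength_pos h.ne)))

theorem exists_gap {n : ℕ} (hn : 2 ≤ n) {a y x : Angle} (hy : double^[n] y = y)
    (hx : double^[n] x = x) (hs : SameSide a y x) (hne : y ≠ x) : ∃ z, Gap n a y z := by
  classical
  have hq : (0 : ℝ) < 2 ^ n - 1 := by linarith [four_le_two_pow hn]
  have hex : ∃ m : ℕ, ∃ z, double^[n] z = z ∧ y ≠ z ∧ SameSide a y z ∧
      ((2 : ℝ) ^ n - 1) * arcLength y z = m := by
    obtain ⟨m, hm⟩ := exists_nat_mul_arcLength hy hx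
    exact ⟨m, x, hx, hne, hs, hm⟩
  obtain ⟨z, hz, hyz, hsz, hm⟩ := Nat.find_spec hex
  refine ⟨z, hy, hz, hyz, hsz, fun w hw hsw h0 => ?_⟩
  obtain ⟨m, hm'⟩ := exists_nat_mul_arcLength hy hw
  have hle : Nat.find hex ≤ m := Nat.find_min' hex
    ⟨w, hw, fun h => by rw [h, arcLength_self] at h0; exact lt_irrefl _ h0, hsw, hm'⟩
  refine le_of_mul_le_mul_left ?_ hq
  rw [hm, hm']
  exact_mod_cast hle

namespace NarrowPair

variable {n : ℕ} {α β : Angle}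

theorem sameSide (h : NarrowPair n α β) : SameSide (double^[n - 1] α) α β := by
  intro k
  have hn : 0 < n := by have := h.two_le; omega
  have e : ∀ x : Angle, double^[n] x = x → double^[k] x = double^[k % n] x := fun x hx => by
    conv_lhs => rw [← Nat.mod_add_div k n, Function.iterate_add_apply, iterate_mul_fixed hx]
  rw [e α h.iterate_left, e β h.iterate_right]
  exact h.same_side _ (Nat.mod_lt _ hn)

/-- A shortest gap that is not an iterate of the narrow arc contains the class of `α`. -/
theorem exists_gap_around (h : NarrowPair n α β) {y₀ z₀ : Angle}
    (hgap : Gap n (double^[n - 1] α) y₀ z₀)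
    (hne : ∀ k, ¬ (double^[k] α = y₀ ∧ double^[k] β = z₀)) :
    ∃ y z, (∀ y' z', Gap n (double^[n - 1] α) y' z' →
        (∀ k, ¬ (double^[k] α = y' ∧ double^[k] β = z')) → arcLength y z ≤ arcLength y' z') ∧
      ∀ w, double^[n] w = w → SameSide (double^[n - 1] α) α w →
        0 < arcLength y w ∧ arcLength y w < arcLength y z := by
  classical
  set a := double^[n - 1] α with ha
  have hda : double a = α := h.double_last
  have hn := h.two_le
  have hq : (0 : ℝ) < 2 ^ n - 1 := by linarith [four_le_two_pow hn]
  have hex : ∃ m : ℕ, ∃ y z, Gap n a y z ∧ (∀ k, ¬ (double^[k] α = y ∧ double^[k] β = z)) ∧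
      ((2 : ℝ) ^ n - 1) * arcLength y z = m := by
    obtain ⟨m, hm⟩ := exists_nat_mul_arcLength hgap.left hgap.right
    exact ⟨m, y₀, z₀, hgap, hne, hm⟩
  obtain ⟨y, z, hg, hJ, hm⟩ := Nat.find_spec hex
  have hmin : ∀ y' z', Gap n a y' z' → (∀ k, ¬ (double^[k] α = y' ∧ double^[k] β = z')) →
      arcLength y z ≤ arcLength y' z' := by
    intro y' z' hg' hJ'
    obtain ⟨m, hm'⟩ := exists_nat_mul_arcLength hg'.left hg'.right
    have hle : Nat.find hex ≤ m := Nat.find_min' hex ⟨y', z', hg', hJ', hm'⟩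
    refine le_of_mul_le_mul_left ?_ hq
    rw [hm, hm']
    exact_mod_cast hle
  refine ⟨y, z, hmin, ?_⟩
  -- the preimage of the gap is longer than a half circle
  have e1 : ∀ x : Angle, double^[n] x = x → double (double^[n - 1] x) = x := fun x hx => by
    rw [← Function.iterate_succ_apply' double, Nat.succ_eq_add_one, Nat.sub_add_cancel (by omega),
      hx]
  have hg' := hg.iterate (k := n - 1) (by omega)
  have hy' := e1 y hg.left
  have hz' := e1 z hg.right
  generalize double^[n - 1] y = y' at *
  generalize double^[n - 1] z = z' at *
  have hJ' : ∀ k, ¬ (double^[k] α = y' ∧ double^[k] β = z') := by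
    rintro k ⟨rfl, rfl⟩
    apply hJ (k + 1)
    rw [Function.iterate_succ_apply', Function.iterate_succ_apply']
    exact ⟨hy', hz'⟩
  have hle := hmin _ _ hg' hJ'
  have hpos := arcLength_pos hg'.ne
  have hU : Upper a y' ↔ Upper a z' := hg'.sameSide 0
  -- If the preimage arc stayed in one half circle, doubling would double its length, against
  -- minimality. So it contains the other half circle, and its image contains α.
  have hyα : arcLength y α < arcLength y z := by
    have hc := Upper.arcLength_cases hU
    rw [hy', hz'] at hc
    rcases hc with ⟨-, c2, c3⟩ | ⟨-, c2, c3⟩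
    · linarith
    · have hz1 := arcLength_lt_one z' a
      have d1 := arcLength_double_of_lt (x := y') (y := a)
      have d2 := arcLength_double_of_ge (x := y') (y := a)
      rw [hy', hda] at d1 d2
      by_cases hUy : Upper a y'
      · have := d2 hUy
        linarith
      · have hUz : ¬ Upper a z' := fun h => hUy (hU.2 h)
        rw [Upper, not_le] at hUy hUz
        have := d1 hUy
        linarith
  have hαz : α ≠ z := by rintro rfl; exact lt_irrefl _ hyα
  have hl := h.length_le_of_fixed h.iterate_left hg.right hαz
  have hαz' := arcLength_of_le hyα.le
  have hy1 := arcLength_lt_one y z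
  -- A gap has no class point inside, so y would be α; then β, at the least possible distance, would
  -- be z, and the gap would be the narrow arc.
  have hns : ¬ SameSide a y α := by
    intro hs
    have hyα' : y = α := by
      by_contra hyα'
      exact absurd (hg.empty α h.iterate_left hs (arcLength_pos hyα')) (not_le.2 hyα)
    subst hyα'
    have := hg.empty β h.iterate_right h.sameSide h.length_pos
    exact hJ 0 ⟨rfl, arcLength_right_injective (le_antisymm hl this)⟩
  have hyα0 : 0 < arcLength y α := arcLength_pos (by rintro rfl; exact hns fun k => Iff.rfl)
  intro w hw hs
  have hyw : y ≠ w := by rintro rfl; exact hns hs.symm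
  refine ⟨arcLength_pos hyw, ?_⟩
  by_contra! hcon
  rcases hcon.eq_or_lt with heq | hlt
  · have := arcLength_right_injective heq
    subst this
    exact hns (hg.sameSide.trans hs.symm)
  · exact hns (hs.of_crossing hg.sameSide hyα0 hyα hlt)

/-- The class of `α` consists of `β` and of points of the orbit of `α`. -/
theorem eq_of_sameSide (h : NarrowPair n α β) {x : Angle} (hx : double^[n] x = x)
    (hs : SameSide (double^[n - 1] α) α x) (hxα : ∀ k, double^[k] α ≠ x) : x = β := by
  by_contra hxβ
  have hn := h.two_le
  have hn0 : 0 < n := by omega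
  set a := double^[n - 1] α with ha
  have hαx : α ≠ x := hxα 0
  obtain ⟨x', hgx⟩ := exists_gap hn hx h.iterate_left hs.symm hαx.symm
  obtain ⟨y, z, hmin, hin⟩ := h.exists_gap_around hgx fun k hk => hxα k hk.1
  -- Such a gap is at least as long as the one from y to z, yet both its ends lie strictly inside;
  -- so it goes round the circle, and w is the last point of the class seen from y.
  have hwrap : ∀ w w', SameSide a α w → Gap n a w w' → (∀ k, double^[k] α ≠ w) →
      arcLength w w' = arcLength y w' - arcLength y w + 1 := by
    intro w w' hsw hg hw
    have h1 := hmin _ _ hg fun k hk => hw k hk.1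
    have h2 := hin w hg.left hsw
    have h3 := hin w' hg.right (hsw.trans hg.sameSide)
    refine arcLength_of_lt ?_
    by_contra! hle
    have := arcLength_of_le hle
    linarith
  -- There is only one last point, and x is it.
  have horbit : ∀ w, double^[n] w = w → SameSide a α w → w ≠ x → ∃ k, double^[k] α = w := by
    intro w hw hsw hwx
    by_contra! hwα
    obtain ⟨w', hgw⟩ := exists_gap hn hw hx (hsw.symm.trans hs) hwx
    have h1 := hwrap _ _ hs hgx hxα
    have h2 := hwrap _ _ hsw hgw hwα
    have h3 := hgx.empty w hw (hs.symm.trans hsw) (arcLength_pos hwx.symm)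
    have h4 := hgw.empty x hx (hsw.symm.trans hs) (arcLength_pos hwx)
    have h5 := arcLength_lt_one y x
    have h6 := arcLength_lt_one y w
    have h7 := arcLength_nonneg y x'
    have h8 := arcLength_nonneg y w'
    have h9 := (hin x' hgx.right (hs.trans hgx.sameSide)).1
    have h10 := (hin w' hgw.right (hsw.trans hgw.sameSide)).1
    rcases le_total (arcLength y w) (arcLength y x) with hle | hle
    · have := arcLength_of_le hle
      linarith
    · have := arcLength_of_le hle
      linarith
  obtain ⟨k, hk⟩ := horbit β h.iterate_right h.sameSide (Ne.symm hxβ)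
  have hsk : ∀ w, SameSide a α w → SameSide a α (double^[k] w) := fun w hw => by
    have := hw.iterate k
    rw [hk] at this
    exact h.sameSide.trans this
  -- With β = h^k(α), the class is invariant under h^k, and x is its only point off the orbit of α.
  -- So h^k fixes x and the successor x' of x; as x' is on the orbit of α, h^k fixes α too, giving β
  -- = α.
  have hkx : double^[k] x = x := by
    by_contra hkx
    obtain ⟨j, hj⟩ := horbit _ (iterate_fixed hx k) (hsk x hs) hkx
    have := iterate_sub_iterate hn0 hx k
    rw [← hj, ← Function.iterate_add_apply] at this
    exact hxα _ this
  have hkx' : double^[k] x' = x' := by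
    have := hgx.iterate hn0 k
    rw [hkx] at this
    exact this.unique hgx
  obtain ⟨i, hi⟩ := horbit x' hgx.right (hs.trans hgx.sameSide) hgx.ne.symm
  rw [← hi, iterate_comm] at hkx'
  have h1 := iterate_sub_iterate hn0 h.iterate_left i
  have h2 := iterate_sub_iterate hn0 (iterate_fixed h.iterate_left k) i
  rw [hkx', h1, hk] at h2
  exact h.ne h2

end NarrowPair

/-! ### Infinite runs -/

open Filter Topology in
/-- An expanding affine recursion modulo `1` has no convergent orbit whose terms all differ from
the next ones. -/
theorem exists_eq_succ_of_tendsto {b l : ℝ} (hb : 1 ≤ b) {c : ℕ → ℝ}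
    (hc : ∀ m, ∃ j : ℤ, c (m + 1) = b * c m - j) (hl : Tendsto c atTop (𝓝 l)) :
    ∃ m, c (m + 1) = c m := by
  by_contra! hne
  have hd : Tendsto (fun m => c (m + 1) - c m) atTop (𝓝 0) := by
    have := (hl.comp (tendsto_add_atTop_nat 1)).sub hl
    rwa [sub_self] at this
  -- Successive differences satisfy d' = bd - j with an integer j. Once both are below 1/(b + 1),
  -- |j| < 1, so j = 0 and the differences stop shrinking.
  have hε : (0 : ℝ) < 1 / (b + 1) := by positivity
  obtain ⟨M, hM⟩ := (Metric.tendsto_atTop.1 hd) _ hε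
  simp only [dist_zero_right, Real.norm_eq_abs] at hM
  have hstep : ∀ m ≥ M, c (m + 2) - c (m + 1) = b * (c (m + 1) - c m) := by
    intro m hm
    obtain ⟨j, hj⟩ := hc m
    obtain ⟨j', hj'⟩ := hc (m + 1)
    have h1 : c (m + 2) - c (m + 1) = b * (c (m + 1) - c m) - ((j' - j : ℤ) : ℝ) := by
      push_cast; linarith
    have h2 := hM m hm
    have h3 : |c (m + 2) - c (m + 1)| < 1 / (b + 1) := hM (m + 1) (by omega)
    have h4 : |((j' - j : ℤ) : ℝ)| < 1 := by
      calc |((j' - j : ℤ) : ℝ)| = |b * (c (m + 1) - c m) - (c (m + 2) - c (m + 1))| := by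
            rw [h1]; congr 1; ring
        _ ≤ |b * (c (m + 1) - c m)| + |c (m + 2) - c (m + 1)| := abs_sub _ _
        _ = b * |c (m + 1) - c m| + |c (m + 2) - c (m + 1)| := by
            rw [abs_mul, abs_of_nonneg (by linarith : (0 : ℝ) ≤ b)]
        _ < b * (1 / (b + 1)) + 1 / (b + 1) := by
            have := mul_lt_mul_of_pos_left h2 (by linarith : (0 : ℝ) < b)
            linarith
        _ = 1 := by field_simp
    have h5 : j' - j = 0 := by
      rw [← Int.cast_abs] at h4
      have : |j' - j| < 1 := by exact_mod_cast h4
      exact Int.abs_lt_one_iff.1 this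
    rw [h1, h5]; simp
  have hgrow : ∀ k, |c (M + 1) - c M| ≤ |c (M + k + 1) - c (M + k)| := by
    intro k
    induction k with
    | zero => exact le_rfl
    | succ k ih =>
      refine ih.trans ?_
      have := hstep (M + k) (by omega)
      rw [show M + (k + 1) + 1 = M + k + 2 by ring, ← add_assoc, this, abs_mul,
        abs_of_nonneg (by linarith : (0 : ℝ) ≤ b)]
      exact le_mul_of_one_le_left (abs_nonneg _) hb
  have hpos : 0 < |c (M + 1) - c M| := abs_pos.2 (sub_ne_zero.2 (hne M))
  obtain ⟨M', hM'⟩ := (Metric.tendsto_atTop.1 hd) _ hpos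
  have h1 := hM' (M + M') (by omega)
  simp only [dist_zero_right, Real.norm_eq_abs] at h1
  exact absurd (hgrow M') (not_le.2 h1)

namespace NarrowPair

variable {n : ℕ} {α β : Angle}

open Filter Topology in
/-- A point in the class of `α` that never meets `α` is mapped to a periodic point. -/
theorem exists_iterate_fixed (h : NarrowPair n α β) {x : Angle}
    (hs : SameSide (double^[n - 1] α) α x) (hx : ∀ k, double^[k] x ≠ α) :
    ∃ k, double^[n] (double^[n * k] x) = double^[n * k] x := by
  set c : ℕ → ℝ := fun m => arcLength α (double^[n * m] x) with hc
  have hsucc : ∀ m, double^[n * (m + 1)] x = double^[n] (double^[n * m] x) := fun m => by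
    rw [← Function.iterate_add_apply]; congr 2; ring
  have hrec : ∀ m, ∃ j : ℤ, c (m + 1) = 2 ^ n * c m - j := by
    intro m
    have := exists_int_arcLength_iterate_double α (double^[n * m] x) n
    rwa [h.iterate_left, ← hsucc] at this
  have hsm : ∀ m, SameSide (double^[n - 1] α) α (double^[n * m] x) := fun m => by
    have := hs.iterate (n * m)
    rwa [iterate_mul_fixed h.iterate_left] at this
  have hpos : ∀ m, 0 < c m := fun m => arcLength_pos (hx _).symm
  have hlt1 : ∀ m, c m < 1 := fun m => arcLength_lt_one _ _
  -- h^n fixes α and preserves cyclic order on its class, so the sequence c is monotone or constant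
  -- from the start.
  have hmono : ∀ m m', c m < c m' → c (m + 1) < c (m' + 1) := by
    intro m m' hlt
    have := ((hsm m).arcLength_iterate_lt (hsm m') (hpos m) hlt n).2
    rwa [h.iterate_left, ← hsucc, ← hsucc] at this
  suffices hm : ∃ m, c (m + 1) = c m by
    obtain ⟨m, hm⟩ := hm
    refine ⟨m, ?_⟩
    rw [← hsucc]
    exact arcLength_right_injective hm
  have hb : (1 : ℝ) ≤ 2 ^ n := one_le_pow₀ one_le_two
  rcases lt_trichotomy (c 0) (c 1) with h01 | h01 | h01
  · have hstep : ∀ m, c m ≤ c (m + 1) := fun m => by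
      refine le_of_lt ?_
      induction m with
      | zero => exact h01
      | succ m ih => exact hmono _ _ ih
    exact exists_eq_succ_of_tendsto hb hrec (tendsto_atTop_ciSup (monotone_nat_of_le_succ hstep)
      ⟨1, by rintro _ ⟨m, rfl⟩; exact (hlt1 m).le⟩)
  · exact ⟨0, h01.symm⟩
  · have hstep : ∀ m, c (m + 1) ≤ c m := fun m => by
      refine le_of_lt ?_
      induction m with
      | zero => exact h01
      | succ m ih => exact hmono _ _ ih
    exact exists_eq_succ_of_tendsto hb hrec (tendsto_atTop_ciInf (antitone_nat_of_succ_le hstep)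
      ⟨0, by rintro _ ⟨m, rfl⟩; exact (hpos m).le⟩)

theorem not_sameSide (h : NarrowPair n α β) {x : Angle} (hα : ∀ k, double^[k] x ≠ α)
    (hβ : ∀ k, double^[k] x ≠ β) : ¬ SameSide (double^[n - 1] α) α x := by
  intro hs
  have hn : 0 < n := by have := h.two_le; omega
  obtain ⟨k, hk⟩ := h.exists_iterate_fixed hs hα
  have hs' := hs.iterate (n * k)
  rw [iterate_mul_fixed h.iterate_left] at hs'
  refine hβ _ (h.eq_of_sameSide hk hs' fun j hj => ?_)
  have := iterate_sub_iterate hn h.iterate_left j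
  rw [hj, ← Function.iterate_add_apply] at this
  exact hα _ this

end NarrowPair

end Narrow

/-! ### Comparison of the two itineraries -/

theorem theorem4 (α β : Narrow.Angle) (hnarrow : Narrow.IsNarrowArc α β)
    (θ : Narrow.Angle) (hα : ¬ Narrow.IsPrecritical α θ) (hβ : ¬ Narrow.IsPrecritical β θ) :
    ∃ s : ℕ → Fin 2,
      (∀ i, Narrow.itinerary α θ i = some (s i)) ∧
      (∀ i, Narrow.itinerary β θ i = some (Narrow.phi α s i)) := by
  classical
  open Narrow in
  have h := hnarrow.narrowPair.1
  have hn := h.two_le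
  have hα' : ∀ k, double^[k] θ ≠ α := fun k hk => hα ⟨k, hk⟩
  have hβ' : ∀ k, double^[k] θ ≠ β := fun k hk => hβ ⟨k, hk⟩
  have hd : ∀ k, double (double^[k] θ) = double^[k + 1] θ := fun k =>
    (Function.iterate_succ_apply' _ _ _).symm
  have ha : double (dot α) = α := h.double_last
  have hadd : ∀ k l, double^[k] (double^[l] θ) = double^[l + k] θ := fun k l => by
    rw [← Function.iterate_add_apply, add_comm]
  set s : ℕ → Fin 2 := fun i =>
    if Upper (dot α) (double^[i] θ) then upperSymbol α (dot α) else 1 - upperSymbol α (dot α)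
    with hs_def
  have hs : ∀ i, symbol α (double^[i] θ) = some (s i) := fun i =>
    symbol_eq_of_double_ne ha (by rw [hd]; exact hα' _)
  refine ⟨s, hs, fun i => ?_⟩
  have hblock : ∀ j, IsBlock (repetitionWord α) s j ↔ ∀ k < period α - 1,
      (Upper (dot α) (double^[k] (double^[j + 1] θ)) ↔ Upper (dot α) (double^[k] α)) := by
    intro j
    have key : ∀ (k : ℕ) (hk : k < (repetitionWord α).length),
        s (j + 1 + k) = (repetitionWord α)[k] ↔
        (Upper (dot α) (double^[k] (double^[j + 1] θ)) ↔ Upper (dot α) (double^[k] α)) := by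
      intro k hk
      rw [← Option.some_inj, ← hs, ← h.symbol_eq_getElem hk, hadd]
      rw [NarrowPair.length_repetitionWord] at hk
      refine symbol_eq_symbol_iff ha (by rw [hd]; exact hα' _) ?_
      rw [← Function.iterate_succ_apply' double]
      exact h.ne_left _ (by omega) (by omega)
    rw [IsBlock]
    constructor
    · intro hb k hk
      rw [← NarrowPair.length_repetitionWord] at hk
      exact (key k hk).1 (hb k hk)
    · intro hb k hk
      exact (key k hk).2 (hb k (by rwa [NarrowPair.length_repetitionWord] at hk))
  have he : ∀ j, s j = charSymbol α ↔ Upper (dot α) (double^[j] θ) := by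
    intro j
    rw [h.charSymbol_eq, ← Option.some_inj, ← hs]
    exact symbol_eq_upperSymbol_iff ha (by rw [hd]; exact hα' _)
  have hlen := h.length_repetitionWord_add_one
  have hF : ∀ j, InArc α β (double^[j + 1] θ) ↔ IsBlock (repetitionWord α) s j ∧
      (s (j + ((repetitionWord α).length + 1)) = charSymbol α ∨
        InArc α β (double^[j + ((repetitionWord α).length + 1) + 1] θ)) := by
    intro j
    rw [hlen, hblock, he, h.inArc_iff, hadd, hadd,
      show j + 1 + (period α - 1) = j + period α by omega,
      show j + 1 + period α = j + period α + 1 by omega]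
    rfl
  have hdisj : ∀ j i, 0 < i → i < (repetitionWord α).length + 1 → InArc α β (double^[j + 1] θ) →
      ¬ InArc α β (double^[j + i + 1] θ) := by
    intro j i hi0 hi hj
    have := h.not_inArc_iterate hj hi0 (by omega)
    rwa [hadd, add_right_comm] at this
  have hinf : ∀ j, (∀ k, IsBlock (repetitionWord α) s (j + k * ((repetitionWord α).length + 1))) →
      InArc α β (double^[j + 1] θ) := by
    intro j hb
    by_contra hj
    rw [hlen] at hb
    -- A later visit to the arc would propagate back along the run by the recursion.
    have hnot : ∀ k, ¬ InArc α β (double^[j + k * period α + 1] θ) := by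
      intro k
      induction k with
      | zero => simpa using hj
      | succ k ih =>
        intro h'
        refine ih ((hF _).2 ⟨hb k, Or.inr ?_⟩)
        rwa [hlen, show j + k * period α + period α + 1 = j + (k + 1) * period α + 1 by ring]
    refine h.not_sameSide (x := double^[j + 1] θ) (fun k => by rw [hadd]; exact hα' _)
      (fun k => by rw [hadd]; exact hβ' _) fun i => ?_
    have hi := Nat.mod_add_div i (period α)
    have hr := Nat.mod_lt i (show 0 < period α by omega)
    generalize i % period α = r at hi hr
    generalize i / period α = q at hi
    subst hi
    rw [Function.iterate_add_apply, iterate_mul_fixed h.iterate_left, Function.iterate_add_apply,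
      hadd, show j + 1 + period α * q = j + q * period α + 1 by ring]
    rcases Nat.lt_or_ge r (period α - 1) with hr1 | hr1
    · exact ((hblock _).1 (hb q) r hr1).symm
    · obtain rfl : r = period α - 1 := by omega
      -- The symbol after each block is not e, which matches α̇ at the place of * because the half
      -- circle excludes α̇.
      have h1 : ¬ Upper (dot α) (double^[j + q * period α + period α] θ) := by
        intro hU
        exact hnot q ((hF _).2 ⟨hb q, Or.inl (by rw [he, hlen]; exact hU)⟩)
      have h2 : ¬ Upper (dot α) (dot α) := by
        rw [Upper, arcLength_self]; norm_num
      rw [hadd, show j + q * period α + 1 + (period α - 1) = j + q * period α + period α by omega]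
      exact iff_of_false h2 h1
  have hsw := isSwapped_iff (F := fun j => InArc α β (double^[j + 1] θ)) hF hdisj hinf i
  have := h.symbol_right (by rw [hd]; exact hα' _) (by rw [hd]; exact hβ' _) (hs i)
  rw [itinerary, this, phi, scan, hd]
  by_cases hi : InArc α β (double^[i + 1] θ)
  · rw [if_pos hi, if_pos (hsw.2 hi)]
  · rw [if_neg hi, if_neg (fun h' => hi (hsw.1 h'))]
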